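/- Let $\mathbb C^*=\mathbb C\setminus\{0\}$. A vector field $X=(X_1,X_2)$ on $(\mathbb C^*)^2$ is called \emph{rational holomorphic} if $X$ is holomorphic on $(\mathbb C^*)^2$ and each component is a rational function, i.e. there are polynomials $P_i,Q_i\in\mathbb C[z_1,z_2]$, $Q_i\neq 0$, with $X_i=P_i/Q_i$ at all points of $(\mathbb C^*)^2$ where $Q_i\ne 0$. It is called \emph{complete} if all its integral curves are entire, i.e. for every $c\in(\mathbb C^*)^2$ there is a holomorphic map $\gamma:\mathbb C\to(\mathbb C^*)^2$ with $\gamma(0)=c$ and $\gamma'(t)=X(\gamma(t))$ for all $t\in\mathbb C$. Every complete rational holomorphic vector field on $(\mathbb C^*)^2$ is of the form \[ \dot z_1=z_1\bigl(a_2f(z_1^{a_1}z_2^{a_2})+c_1\bigr),\qquad \dot z_2=-z_2\bigl(a_1f(z_1^{a_1}z_2^{a_2})+c_2\bigr), \] where $f$ is a Laurent polynomial in one variable with complex coefficients, $a_1,a_2$ are integers and $c_1,c_2$ are complex numbers. Conversely, every vector field of this form is a complete rational holomorphic vector field on $(\mathbb C^*)^2$. -/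

import Mathlib

/-- The complex torus `(ℂ*)ⁿ`, as an open subset of `ℂⁿ`. -/
def cstar (n : ℕ) : Set (Fin n → ℂ) :=
  {z | ∀ i, z i ≠ 0}

/-- A vector field on `(ℂ*)ⁿ` (only its values on `(ℂ*)ⁿ` matter) is rational if each of its
components is given by a quotient of polynomials, wherever the denominator does not vanish. -/
def IsRationalField {n : ℕ} (X : (Fin n → ℂ) → (Fin n → ℂ)) : Prop :=
  ∀ i, ∃ P Q : MvPolynomial (Fin n) ℂ, Q ≠ 0 ∧
    ∀ z ∈ cstar n, MvPolynomial.eval z Q ≠ 0 →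
      X z i = MvPolynomial.eval z P / MvPolynomial.eval z Q

/-- A vector field on `(ℂ*)ⁿ` is holomorphic. -/
def IsHolomorphicField {n : ℕ} (X : (Fin n → ℂ) → (Fin n → ℂ)) : Prop :=
  DifferentiableOn ℂ X (cstar n)

/-- A vector field on `(ℂ*)ⁿ` is complete if all its integral curves are entire: through each
point of `(ℂ*)ⁿ` there is an integral curve in `(ℂ*)ⁿ` that is defined for all complex times. -/
def IsCompleteField {n : ℕ} (X : (Fin n → ℂ) → (Fin n → ℂ)) : Prop :=
  ∀ c ∈ cstar n, ∃ γ : ℂ → (Fin n → ℂ), γ 0 = c ∧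
    ∀ t : ℂ, γ t ∈ cstar n ∧ HasDerivAt γ (X (γ t)) t

/-- The value `∑ₖ fₖ wᵏ` of a Laurent polynomial `f` at a (nonzero) complex number `w`. -/
noncomputable def laurentValue (f : LaurentPolynomial ℂ) (w : ℂ) : ℂ :=
  f.coeff.sum fun k a => a * w ^ k

/-! Write X = (z₁U, z₂V). Since U and V are rational and holomorphic on the torus, they are Laurent
polynomials (`exists_mul_prod_pow_eq_eval`). An exponent m = (p, q) carries coefficients a_m in U
and b_m in V.

A single obstruction to completeness drives the proof. For x' = l₁xM, y' = l₂yM with M = x^m₁ y^m₂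
one has M' = κM², where κ = m₁l₁ + m₂l₂. If κ ≠ 0 and M(0) = 1, then M = 1/(1 - κt) has a pole. A
small perturbation cannot remove it: along a loop around 1/κ an entire M would stay close to 1/(1 -
κt), against the maximum principle. So if rescalings of a complete field converge to such a monomial
field, then κ = 0 (`resonance_of_family`).

Rescaling towards a vertex of the Newton polygon gives p a + q b = 0 there (`vertex`). On an edge on
the line p = d with d ≠ 0, rescaling near suitable common zeros of the edge polynomials A, B of a, b
gives a relation at these zeros (`face_root`). These relations prescribe the residues of d·A/(zB) dz
at the roots of B, and the two end vertices prescribe those at 0 and ∞. Their sum is not zero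
(`Polynomial.not_forall_root_relation`), so no supporting line off the origin contains two
exponents. Hence all exponents lie on one line through the origin (`exists_edge`, `collinear`).

Let (k₁, k₂) be a primitive vector on that line. The monomial w = z₁^k₁ z₂^k₂ solves a complete
equation in one variable, which must be linear. Thus k₁a_m + k₂b_m = 0 for m ≠ 0, which is the
asserted form. Conversely, for a field of this form w is an exponential in t, and the coordinates
follow by integration. -/

/-! ### Persistence of poles under perturbation -/

/-- Grönwall's inequality with a bound on the derivative that is only known close to `0`. -/
theorem norm_lt_of_norm_deriv_le_of_norm_le {E : Type*} [NormedAddCommGroup E] [NormedSpace ℝ E]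
    {f f' : ℝ → E} {δ K e T : ℝ} (hf : ∀ θ, HasDerivAt f (f' θ) θ) (h0 : f 0 = 0)
    (hK : 0 < K) (he : 0 < e) (hδ : gronwallBound 0 K e T < δ)
    (hb : ∀ θ ∈ Set.Icc 0 T, ‖f θ‖ ≤ δ → ‖f' θ‖ ≤ K * ‖f θ‖ + e) :
    ∀ θ ∈ Set.Icc 0 T, ‖f θ‖ < δ := by
  have hc : Continuous f := continuous_iff_continuousAt.2 fun θ => (hf θ).continuousAt
  have mono : Monotone (gronwallBound 0 K e) :=
    gronwallBound_mono le_rfl he.le hK.le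
  by_contra! hcon
  obtain ⟨θ₀, hθ₀, hθ₀'⟩ := hcon
  have hcomp : IsCompact (Set.Icc 0 T ∩ {θ | δ ≤ ‖f θ‖}) :=
    isCompact_Icc.inter_right (isClosed_le continuous_const hc.norm)
  -- θ₁ is the first time at which ‖f‖ reaches δ. The derivative bound holds before it, so Grönwall
  -- forbids that value.
  obtain ⟨θ₁, ⟨hθ₁, hθ₁'⟩, hmin⟩ := hcomp.exists_isLeast ⟨θ₀, hθ₀, hθ₀'⟩
  have hlt : ∀ θ ∈ Set.Ico 0 θ₁, ‖f θ‖ < δ := by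
    intro θ hθ
    by_contra! h
    exact absurd (hmin ⟨⟨hθ.1, hθ.2.le.trans hθ₁.2⟩, h⟩) (not_le.2 hθ.2)
  have := norm_le_gronwallBound_of_norm_deriv_right_le (f := f) (f' := f') (δ := 0) (K := K)
    (ε := e) (a := 0) (b := θ₁) hc.continuousOn (fun θ _ => (hf θ).hasDerivWithinAt)
    (by simp [h0])
    (fun θ hθ => hb θ ⟨hθ.1, hθ.2.le.trans hθ₁.2⟩ (hlt θ hθ).le) θ₁ ⟨hθ₁.1, le_rfl⟩
  have h2 := mono (show θ₁ - 0 ≤ T by simpa using hθ₁.2)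
  have h3 : δ ≤ ‖f θ₁‖ := hθ₁'
  linarith

/-- A monomial in two variables is Lipschitz at `(1, 1)`. -/
theorem exists_norm_zpow_mul_zpow_sub_one_le (m₁ m₂ : ℤ) :
    ∃ L > 0, ∃ δ > 0, δ ≤ 1 / 2 ∧ L * δ ≤ 1 / 2 ∧ ∀ q : ℂ × ℂ, ‖q‖ ≤ δ →
      ‖(1 + q.1) ^ m₁ * (1 + q.2) ^ m₂ - 1‖ ≤ L * ‖q‖ := by
  have hd : DifferentiableAt ℂ (fun q : ℂ × ℂ => (1 + q.1) ^ m₁ * (1 + q.2) ^ m₂) 0 := by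
    refine DifferentiableAt.mul ?_ ?_ <;> refine DifferentiableAt.zpow (by fun_prop) ?_ <;> simp
  obtain ⟨L, hL, hO⟩ := hd.isBigO_sub.exists_pos
  obtain ⟨δ, hδ, hball⟩ := Metric.eventually_nhds_iff_ball.1 hO.bound
  refine ⟨L, hL, min (δ / 2) (min (1 / 2) (1 / (2 * L))), by positivity,
    (min_le_right _ _).trans (min_le_left _ _), ?_, ?_⟩
  · calc L * _ ≤ L * (1 / (2 * L)) := by
          gcongr; exact (min_le_right _ _).trans (min_le_right _ _)
      _ = 1 / 2 := by field_simp
  · intro q hq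
    have := hball q (by
      rw [mem_ball_zero_iff]; exact (hq.trans (min_le_left _ _)).trans_lt (by linarith))
    simpa using this

theorem norm_exp_I_mul_le {μ : ℂ} {θ C : ℝ} (hθ : θ ∈ Set.Icc 0 (2 * Real.pi)) (hC : ‖μ‖ ≤ C) :
    ‖Complex.exp (Complex.I * θ * μ)‖ ≤ Real.exp (2 * Real.pi * C) := by
  rw [Complex.norm_exp]
  apply Real.exp_le_exp.2
  refine (Complex.re_le_norm _).trans ?_
  rw [norm_mul, norm_mul, Complex.norm_I, one_mul, Complex.norm_real, Real.norm_of_nonneg hθ.1]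
  have := Real.pi_pos
  gcongr
  exact hθ.2

/-- If a nearly autonomous system `x' = l₁ x M`, `y' = l₂ y M`, where `M` is a monomial in `x`
and `y` with `M' = κ M²`, has entire solutions, then `κ = 0`. -/
theorem exists_forall_not_approx_solution (l₁ l₂ : ℂ) (m₁ m₂ : ℤ) (hκ : m₁ * l₁ + m₂ * l₂ ≠ 0) :
    ∃ R > 0, ∃ ε > 0, ∀ x y : ℂ → ℂ, Differentiable ℂ x → Differentiable ℂ y →
      Differentiable ℂ (fun t => x t ^ m₁ * y t ^ m₂) → x 0 = 1 → y 0 = 1 →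
      ¬ ∀ t, R⁻¹ ≤ ‖x t‖ → ‖x t‖ ≤ R → R⁻¹ ≤ ‖y t‖ → ‖y t‖ ≤ R →
        ‖deriv x t - l₁ * x t * (x t ^ m₁ * y t ^ m₂)‖ ≤ ε ∧
        ‖deriv y t - l₂ * y t * (x t ^ m₁ * y t ^ m₂)‖ ≤ ε := by
  obtain ⟨L, hL, δ, hδ, hδ2, hLδ, hM⟩ := exists_norm_zpow_mul_zpow_sub_one_le m₁ m₂
  set κ : ℂ := m₁ * l₁ + m₂ * l₂ with hκdef
  have hκ' : 0 < ‖κ‖ := norm_pos_iff.2 hκ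
  set C : ℝ := max ‖l₁ / κ‖ ‖l₂ / κ‖ with hCdef
  -- On the loop used below the exact solutions are exp(-iθl/κ), of modulus between (R/2)⁻¹ and R/2.
  -- The factor 2 leaves room for the perturbation.
  set R : ℝ := 2 * Real.exp (2 * Real.pi * C) with hRdef
  have hR : 0 < R := by positivity
  set Λ : ℝ := max ‖l₁‖ ‖l₂‖ with hΛdef
  have hΛ : 0 ≤ Λ := (norm_nonneg _).trans (le_max_left _ _)
  set K : ℝ := 2 * Λ * L / ‖κ‖ + 1 with hKdef
  have hK : 0 < K := by positivity
  have hlim : Filter.Tendsto (fun e => gronwallBound 0 K e (2 * Real.pi))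
      (nhdsWithin 0 (Set.Ioi 0)) (nhds 0) := by
    have : Continuous (fun e => gronwallBound 0 K e (2 * Real.pi)) := by
      simp only [gronwallBound_of_K_ne_0 hK.ne']
      fun_prop
    have h := this.tendsto 0
    simp only [gronwallBound_ε0, zero_mul] at h
    exact h.mono_left nhdsWithin_le_nhds
  obtain ⟨e, hebd, he⟩ := ((hlim.eventually (gt_mem_nhds hδ)).and self_mem_nhdsWithin).exists
  have he : 0 < e := he
  refine ⟨R, hR, e * ‖κ‖ / R, by positivity, ?_⟩
  intro x y hx hy hxy hx0 hy0 happ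
  -- The circle through 0 around the pole 1/κ, on which 1 - κτ = exp(iθ).
  set τ : ℝ → ℂ := fun θ => (1 - Complex.exp (Complex.I * θ)) / κ with hτ
  have hτ' : ∀ θ : ℝ, HasDerivAt τ (-(Complex.I / κ) * Complex.exp (Complex.I * θ)) θ := by
    intro θ
    have h1 : HasDerivAt (fun θ : ℝ => Complex.I * (θ : ℂ)) Complex.I θ := by
      simpa using (Complex.ofRealCLM.hasDerivAt (x := θ)).const_mul Complex.I
    have := (h1.cexp.const_sub 1).div_const κ
    rw [show -(Complex.I / κ) * Complex.exp (Complex.I * θ) =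
      -(Complex.exp (Complex.I * θ) * Complex.I) / κ by ring]
    exact this
  have comp : ∀ (l : ℂ) (z : ℂ → ℂ), Differentiable ℂ z → ∀ θ : ℝ,
      HasDerivAt (fun θ : ℝ => z (τ θ) * Complex.exp (Complex.I * θ * (l / κ)) - 1)
        (Complex.exp (Complex.I * θ * (l / κ)) *
          (deriv z (τ θ) * (-(Complex.I / κ) * Complex.exp (Complex.I * θ)) +
            Complex.I * (l / κ) * z (τ θ))) θ := by
    intro l z hz θ
    have h1 : HasDerivAt (fun θ : ℝ => Complex.I * (θ : ℂ) * (l / κ)) (Complex.I * (l / κ)) θ := by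
      simpa using ((Complex.ofRealCLM.hasDerivAt (x := θ)).const_mul Complex.I).mul_const (l / κ)
    have h2 : HasDerivAt (fun θ : ℝ => z (τ θ))
        (deriv z (τ θ) * (-(Complex.I / κ) * Complex.exp (Complex.I * θ))) θ :=
      (hz (τ θ)).hasDerivAt.comp θ (hτ' θ)
    refine ((h2.mul h1.cexp).sub_const 1).congr_deriv ?_
    ring
  -- The relative deviation from the exact solution; it vanishes identically when there is no
  -- perturbation.
  set f : ℝ → ℂ × ℂ := fun θ =>
    (x (τ θ) * Complex.exp (Complex.I * θ * (l₁ / κ)) - 1,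
      y (τ θ) * Complex.exp (Complex.I * θ * (l₂ / κ)) - 1) with hf
  have hexpM : ∀ θ : ℝ, Complex.exp (Complex.I * θ * (l₁ / κ)) ^ m₁ *
      Complex.exp (Complex.I * θ * (l₂ / κ)) ^ m₂ = Complex.exp (Complex.I * θ) := by
    intro θ
    rw [← Complex.exp_int_mul, ← Complex.exp_int_mul, ← Complex.exp_add]
    congr 1
    field_simp
    rw [hκdef]
  have hMf : ∀ θ : ℝ, (1 + (f θ).1) ^ m₁ * (1 + (f θ).2) ^ m₂ =
      Complex.exp (Complex.I * θ) * (x (τ θ) ^ m₁ * y (τ θ) ^ m₂) := by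
    intro θ
    simp only [hf, add_sub_cancel, mul_zpow]
    rw [← hexpM]; ring
  have key : ∀ θ ∈ Set.Icc 0 (2 * Real.pi), ∀ (l : ℂ) (z z' M : ℂ), ‖l / κ‖ ≤ C → ‖l‖ ≤ Λ →
      ‖z * Complex.exp (Complex.I * θ * (l / κ)) - 1‖ ≤ δ →
      ‖Complex.exp (Complex.I * θ) * M - 1‖ ≤ L * ‖f θ‖ →
      (R⁻¹ ≤ ‖z‖ ∧ ‖z‖ ≤ R) ∧
      (‖z' - l * z * M‖ ≤ e * ‖κ‖ / R →
        ‖Complex.exp (Complex.I * θ * (l / κ)) *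
          (z' * (-(Complex.I / κ) * Complex.exp (Complex.I * θ)) +
            Complex.I * (l / κ) * z)‖ ≤ K * ‖f θ‖ + e) := by
    intro θ hθ l z z' M hlC hlΛ hz hMz
    set E := Complex.exp (Complex.I * θ * (l / κ)) with hE
    have hE1 : ‖E‖ ≤ R / 2 := by
      rw [hRdef, mul_div_cancel_left₀ _ two_ne_zero]; exact norm_exp_I_mul_le hθ hlC
    have hE2 : ‖E⁻¹‖ ≤ R / 2 := by
      rw [hRdef, mul_div_cancel_left₀ _ two_ne_zero, hE, ← Complex.exp_neg, ← mul_neg]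
      exact norm_exp_I_mul_le hθ (by rwa [norm_neg])
    have hE0 : 0 < ‖E‖ := norm_pos_iff.2 (Complex.exp_ne_zero _)
    have hzE1 : ‖z * E‖ ≤ 2 := by
      calc ‖z * E‖ = ‖(z * E - 1) + 1‖ := by ring_nf
        _ ≤ ‖z * E - 1‖ + ‖(1 : ℂ)‖ := norm_add_le _ _
        _ ≤ 2 := by rw [norm_one]; linarith
    have hzE2 : 1 / 2 ≤ ‖z * E‖ := by
      have : ‖(1 : ℂ)‖ ≤ ‖z * E‖ + ‖z * E - 1‖ := by
        calc ‖(1 : ℂ)‖ = ‖z * E - (z * E - 1)‖ := by rw [sub_sub_cancel]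
          _ ≤ _ := norm_sub_le _ _
      rw [norm_one] at this; linarith
    refine ⟨⟨?_, ?_⟩, ?_⟩
    · rw [norm_mul] at hzE2
      rw [inv_le_iff_one_le_mul₀ hR]
      have := mul_le_mul_of_nonneg_left hE1 (norm_nonneg z)
      linarith
    · have : z = z * E * E⁻¹ := by rw [mul_assoc, mul_inv_cancel₀ (Complex.exp_ne_zero _), mul_one]
      rw [this, norm_mul]
      calc ‖z * E‖ * ‖E⁻¹‖ ≤ 2 * (R / 2) := by gcongr
        _ = R := by ring
    · intro hz'
      have heq : E * (z' * (-(Complex.I / κ) * Complex.exp (Complex.I * θ)) +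
            Complex.I * (l / κ) * z) =
          -(Complex.I / κ) * (l * (z * E) * (Complex.exp (Complex.I * θ) * M - 1)) +
          -(Complex.I / κ) * (E * Complex.exp (Complex.I * θ) * (z' - l * z * M)) := by
        ring
      have hI : ‖-(Complex.I / κ)‖ = 1 / ‖κ‖ := by simp
      have hexp1 : ‖Complex.exp (Complex.I * θ)‖ = 1 := by
        rw [mul_comm]; exact Complex.norm_exp_ofReal_mul_I θ
      rw [heq]
      refine (norm_add_le _ _).trans ?_
      simp only [norm_mul (-(Complex.I / κ)), hI]
      have h1 : ‖l * (z * E) * (Complex.exp (Complex.I * θ) * M - 1)‖ ≤ Λ * 2 * (L * ‖f θ‖) := by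
        rw [norm_mul, norm_mul l]; gcongr
      have h2 : ‖E * Complex.exp (Complex.I * θ) * (z' - l * z * M)‖ ≤ R / 2 * (e * ‖κ‖ / R) := by
        rw [norm_mul, norm_mul E, hexp1, mul_one]; gcongr
      calc 1 / ‖κ‖ * _ + 1 / ‖κ‖ * _
          ≤ 1 / ‖κ‖ * (Λ * 2 * (L * ‖f θ‖)) + 1 / ‖κ‖ * (R / 2 * (e * ‖κ‖ / R)) := by gcongr
        _ = 2 * Λ * L / ‖κ‖ * ‖f θ‖ + e / 2 := by field_simp
        _ ≤ K * ‖f θ‖ + e := by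
          have := norm_nonneg (f θ)
          rw [hKdef]; nlinarith
  have hsmall : ∀ θ ∈ Set.Icc 0 (2 * Real.pi), ‖f θ‖ < δ := by
    refine norm_lt_of_norm_deriv_le_of_norm_le (f := f)
      (fun θ => (comp l₁ x hx θ).prodMk (comp l₂ y hy θ)) ?_ hK he hebd ?_
    · simp [hf, hτ, hx0, hy0]
    · intro θ hθ hfθ
      have hMθ : ‖Complex.exp (Complex.I * θ) * (x (τ θ) ^ m₁ * y (τ θ) ^ m₂) - 1‖ ≤
          L * ‖f θ‖ := by
        rw [← hMf]; exact hM _ hfθ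
      obtain ⟨hb1, hd1⟩ := key θ hθ l₁ (x (τ θ)) (deriv x (τ θ)) _ (le_max_left _ _)
        (le_max_left _ _) ((norm_fst_le (f θ)).trans hfθ) hMθ
      obtain ⟨hb2, hd2⟩ := key θ hθ l₂ (y (τ θ)) (deriv y (τ θ)) _ (le_max_right _ _)
        (le_max_right _ _) ((norm_snd_le (f θ)).trans hfθ) hMθ
      have := happ (τ θ) hb1.1 hb1.2 hb2.1 hb2.2
      exact norm_prod_le_iff.2 ⟨hd1 this.1, hd2 this.2⟩
  -- With ζ = 1 - κt, this is M/M_exact - 1. It is at most 1/2 in modulus on |ζ| = 1 but equals -1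
  -- at ζ = 0.
  have hdiff : Differentiable ℂ (fun ζ : ℂ =>
      ζ * (x ((1 - ζ) / κ) ^ m₁ * y ((1 - ζ) / κ) ^ m₂) - 1) :=
    (differentiable_id.mul (hxy.comp (f := fun ζ : ℂ => (1 - ζ) / κ) (by fun_prop))).sub_const 1
  have hbound := Complex.norm_le_of_forall_mem_frontier_norm_le (U := Metric.ball (0 : ℂ) 1)
    Metric.isBounded_ball hdiff.diffContOnCl (C := 1 / 2) (z := 0) (by
      intro ζ hζ
      rw [frontier_ball _ one_ne_zero, mem_sphere_zero_iff_norm] at hζ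
      have hζ' : ζ = Complex.exp (Complex.I * (toIcoMod Real.two_pi_pos 0 (Complex.arg ζ) : ℝ)) := by
        conv_lhs => rw [← Complex.norm_mul_exp_arg_mul_I ζ, hζ]
        rw [toIcoMod, Complex.ofReal_one, one_mul, Complex.exp_eq_exp_iff_exists_int]
        refine ⟨toIcoDiv Real.two_pi_pos 0 (Complex.arg ζ), ?_⟩
        simp only [zsmul_eq_mul]
        push_cast
        ring
      set θ : ℝ := toIcoMod Real.two_pi_pos 0 (Complex.arg ζ)
      have hθ : θ ∈ Set.Icc 0 (2 * Real.pi) := by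
        have := toIcoMod_mem_Ico Real.two_pi_pos 0 (Complex.arg ζ)
        rw [zero_add] at this
        exact Set.Ico_subset_Icc_self this
      have hlt := (hsmall θ hθ).le
      have h3 := hM _ hlt
      rw [hMf θ, hτ] at h3
      simp only at h3
      rw [← hζ'] at h3
      refine h3.trans (le_trans ?_ hLδ)
      gcongr) (subset_closure (Metric.mem_ball_self one_pos))
  norm_num at hbound

/-- The limit of a family of vector fields with entire solutions: if the limiting field is
`x' = l₁ x M`, `y' = l₂ y M` with a monomial `M` in `x` and `y`, then `M` is a first integral
of it. -/
theorem resonance_of_family {l₁ l₂ : ℂ} {m₁ m₂ : ℤ} (F₁ F₂ : ℂ → ℂ × ℂ → ℂ)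
    (hF₁ : ∀ z : ℂ × ℂ, z.1 ≠ 0 → z.2 ≠ 0 →
      ContinuousAt (fun w : ℂ × (ℂ × ℂ) => F₁ w.1 w.2) (0, z))
    (hF₂ : ∀ z : ℂ × ℂ, z.1 ≠ 0 → z.2 ≠ 0 →
      ContinuousAt (fun w : ℂ × (ℂ × ℂ) => F₂ w.1 w.2) (0, z))
    (h₁ : ∀ z : ℂ × ℂ, z.1 ≠ 0 → z.2 ≠ 0 → F₁ 0 z = l₁ * z.1 * (z.1 ^ m₁ * z.2 ^ m₂))
    (h₂ : ∀ z : ℂ × ℂ, z.1 ≠ 0 → z.2 ≠ 0 → F₂ 0 z = l₂ * z.2 * (z.1 ^ m₁ * z.2 ^ m₂))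
    (hsol : ∀ᶠ η in nhdsWithin (0 : ℂ) {0}ᶜ, ∃ x y : ℂ → ℂ, x 0 = 1 ∧ y 0 = 1 ∧
      Differentiable ℂ (fun t => x t ^ m₁ * y t ^ m₂) ∧
      ∀ t, HasDerivAt x (F₁ η (x t, y t)) t ∧ HasDerivAt y (F₂ η (x t, y t)) t) :
    m₁ * l₁ + m₂ * l₂ = 0 := by
  by_contra hκ
  obtain ⟨R, hR, ε, hε, hno⟩ := exists_forall_not_approx_solution l₁ l₂ m₁ m₂ hκ
  set A : Set ℂ := {z | R⁻¹ ≤ ‖z‖ ∧ ‖z‖ ≤ R} with hA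
  have hAc : IsCompact A := by
    refine (isCompact_closedBall (0 : ℂ) R).of_isClosed_subset ?_ ?_
    · exact (isClosed_le continuous_const continuous_norm).inter
        (isClosed_le continuous_norm continuous_const)
    · intro z hz; simpa using hz.2
  have hA0 : ∀ z ∈ A, z ≠ 0 := by
    rintro z hz rfl
    have : R⁻¹ ≤ 0 := by simpa using hz.1
    exact absurd (inv_pos.2 hR) (not_lt.2 this)
  have unif : ∀ F : ℂ → ℂ × ℂ → ℂ, (∀ z : ℂ × ℂ, z.1 ≠ 0 → z.2 ≠ 0 →
      ContinuousAt (fun w : ℂ × (ℂ × ℂ) => F w.1 w.2) (0, z)) →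
      ∀ᶠ η in nhds (0 : ℂ), ∀ z ∈ A ×ˢ A, ‖F η z - F 0 z‖ ≤ ε := by
    intro F hF
    refine (hAc.prod hAc).eventually_forall_of_forall_eventually ?_
    intro z hz
    have hc := hF z (hA0 _ hz.1) (hA0 _ hz.2)
    have hc0 : ContinuousAt (fun w : ℂ × (ℂ × ℂ) => F 0 w.2) (0, z) :=
      ContinuousAt.comp (f := fun w : ℂ × (ℂ × ℂ) => ((0 : ℂ), w.2)) (x := ((0 : ℂ), z)) hc
        (by fun_prop)
    have := Filter.Tendsto.eventually_le_const (u := ε) (by simpa using hε) (hc.sub hc0).norm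
    filter_upwards [this] with w hw using hw
  have h3 := ((unif F₁ hF₁).filter_mono nhdsWithin_le_nhds).and
    (((unif F₂ hF₂).filter_mono nhdsWithin_le_nhds).and hsol)
  obtain ⟨η, hu₁, hu₂, x, y, hx0, hy0, hd, hxy⟩ := h3.exists
  refine hno x y (fun t => (hxy t).1.differentiableAt) (fun t => (hxy t).2.differentiableAt) hd
    hx0 hy0 ?_
  intro t ha hb hc hd
  have hz : (x t, y t) ∈ A ×ˢ A := ⟨⟨ha, hb⟩, ⟨hc, hd⟩⟩
  have hx := hA0 _ hz.1
  have hy := hA0 _ hz.2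
  rw [(hxy t).1.deriv, (hxy t).2.deriv]
  have e1 := hu₁ _ hz
  have e2 := hu₂ _ hz
  rw [h₁ _ hx hy] at e1
  rw [h₂ _ hx hy] at e2
  exact ⟨e1, e2⟩

/-! ### Laurent polynomial fields, vertices and monomial coordinates -/

/-- Completeness on `(ℂ*)²` of the vector field
`x' = x ∑ₘ aₘ x ^ pₘ y ^ qₘ`, `y' = y ∑ₘ bₘ x ^ pₘ y ^ qₘ`. -/
def LaurentComplete {ι : Type*} (S : Finset ι) (p q : ι → ℤ) (a b : ι → ℂ) : Prop :=
  ∀ c₁ c₂ : ℂ, c₁ ≠ 0 → c₂ ≠ 0 → ∃ x y : ℂ → ℂ, x 0 = c₁ ∧ y 0 = c₂ ∧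
    ∀ t, x t ≠ 0 ∧ y t ≠ 0 ∧
      HasDerivAt x (x t * ∑ m ∈ S, a m * (x t ^ p m * y t ^ q m)) t ∧
      HasDerivAt y (y t * ∑ m ∈ S, b m * (x t ^ p m * y t ^ q m)) t

namespace LaurentComplete

variable {ι : Type*} {S : Finset ι} {p q : ι → ℤ} {a b : ι → ℂ}

/-- At a vertex of the Newton polygon of a complete field, the exponent annihilates the
coefficient. -/
theorem vertex (h : LaurentComplete S p q a b) (k₁ k₂ : ℤ) {v : ι} (hv : v ∈ S)
    (hmax : ∀ m ∈ S, m ≠ v → k₁ * p m + k₂ * q m < k₁ * p v + k₂ * q v) :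
    p v * a v + q v * b v = 0 := by
  classical
  set d : ℤ := k₁ * p v + k₂ * q v with hd
  -- Scaling x by η^k₁, y by η^k₂ and time by η^d multiplies the term m by η^(e m). Only v survives
  -- at η = 0.
  set e : ι → ℕ := fun m => (d - (k₁ * p m + k₂ * q m)).toNat with he
  have hev : e v = 0 := by simp [he, hd]
  have hem : ∀ m ∈ S, (e m : ℤ) = d - (k₁ * p m + k₂ * q m) := by
    intro m hm
    simp only [he]
    rw [Int.toNat_of_nonneg]
    by_cases hmv : m = v
    · subst hmv; omega
    · have := hmax m hm hmv; omega
  have hsum : ∀ (c : ι → ℂ) (z : ℂ × ℂ),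
      ∑ m ∈ S, c m * ((0 : ℂ) ^ e m * (z.1 ^ p m * z.2 ^ q m)) =
        c v * (z.1 ^ p v * z.2 ^ q v) := by
    intro c z
    rw [Finset.sum_eq_single_of_mem v hv]
    · simp [hev]
    · intro m hm hmv
      have h1 := hmax m hm hmv
      have h2 := hem m hm
      rw [zero_pow (by omega)]; ring
  refine resonance_of_family
    (fun η z => z.1 * ∑ m ∈ S, a m * (η ^ e m * (z.1 ^ p m * z.2 ^ q m)))
    (fun η z => z.2 * ∑ m ∈ S, b m * (η ^ e m * (z.1 ^ p m * z.2 ^ q m)))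
    ?_ ?_ ?_ ?_ ?_
  · intro z h1 h2
    have hz₁ : ∀ k : ℤ, ContinuousAt (fun w : ℂ × (ℂ × ℂ) => w.2.1 ^ k) (0, z) := fun k =>
      ContinuousAt.zpow₀ (by fun_prop) _ (Or.inl h1)
    have hz₂ : ∀ k : ℤ, ContinuousAt (fun w : ℂ × (ℂ × ℂ) => w.2.2 ^ k) (0, z) := fun k =>
      ContinuousAt.zpow₀ (by fun_prop) _ (Or.inl h2)
    fun_prop
  · intro z h1 h2
    have hz₁ : ∀ k : ℤ, ContinuousAt (fun w : ℂ × (ℂ × ℂ) => w.2.1 ^ k) (0, z) := fun k =>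
      ContinuousAt.zpow₀ (by fun_prop) _ (Or.inl h1)
    have hz₂ : ∀ k : ℤ, ContinuousAt (fun w : ℂ × (ℂ × ℂ) => w.2.2 ^ k) (0, z) := fun k =>
      ContinuousAt.zpow₀ (by fun_prop) _ (Or.inl h2)
    fun_prop
  · intro z _ _
    simp only [hsum]; ring
  · intro z _ _
    simp only [hsum]; ring
  · filter_upwards [self_mem_nhdsWithin] with η hη
    have hη : η ≠ 0 := hη
    obtain ⟨x, y, hx0, hy0, hxy⟩ := h (η ^ (-k₁)) (η ^ (-k₂)) (zpow_ne_zero _ hη)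
      (zpow_ne_zero _ hη)
    have hT : ∀ t : ℂ, HasDerivAt (fun t : ℂ => η ^ d * t) (η ^ d) t := fun t => by
      simpa using (hasDerivAt_id t).const_mul (η ^ d)
    have hx' : ∀ t, HasDerivAt (fun t => η ^ k₁ * x (η ^ d * t)) _ t := fun t =>
      ((hxy (η ^ d * t)).2.2.1.comp t (hT t)).const_mul (η ^ k₁)
    have hy' : ∀ t, HasDerivAt (fun t => η ^ k₂ * y (η ^ d * t)) _ t := fun t =>
      ((hxy (η ^ d * t)).2.2.2.comp t (hT t)).const_mul (η ^ k₂)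
    have hmon : ∀ t, ∀ m ∈ S, x (η ^ d * t) ^ p m * y (η ^ d * t) ^ q m * η ^ d =
        η ^ e m * ((η ^ k₁ * x (η ^ d * t)) ^ p m * (η ^ k₂ * y (η ^ d * t)) ^ q m) := by
      intro t m hm
      generalize x (η ^ d * t) = X
      generalize y (η ^ d * t) = Y
      rw [mul_zpow, mul_zpow, ← zpow_natCast η (e m), hem m hm, zpow_sub₀ hη,
        zpow_add₀ hη (k₁ * p m), zpow_mul, zpow_mul]
      have h1 : (η ^ k₁) ^ p m ≠ 0 := zpow_ne_zero _ (zpow_ne_zero _ hη)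
      have h2 : (η ^ k₂) ^ q m ≠ 0 := zpow_ne_zero _ (zpow_ne_zero _ hη)
      field_simp
    refine ⟨fun t => η ^ k₁ * x (η ^ d * t), fun t => η ^ k₂ * y (η ^ d * t), ?_, ?_, ?_, ?_⟩
    · simp [hx0, zpow_ne_zero _ hη]
    · simp [hy0, zpow_ne_zero _ hη]
    · intro t
      exact ((hx' t).differentiableAt.zpow (Or.inl (mul_ne_zero (zpow_ne_zero _ hη)
        (hxy _).1))).mul ((hy' t).differentiableAt.zpow (Or.inl (mul_ne_zero (zpow_ne_zero _ hη)
        (hxy _).2.1)))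
    · intro t
      refine ⟨(hx' t).congr_deriv ?_, (hy' t).congr_deriv ?_⟩
      · rw [mul_assoc (x _), Finset.sum_mul, ← mul_assoc]
        congr 1
        refine Finset.sum_congr rfl fun m hm => ?_
        rw [mul_assoc, hmon t m hm]
      · rw [mul_assoc (y _), Finset.sum_mul, ← mul_assoc]
        congr 1
        refine Finset.sum_congr rfl fun m hm => ?_
        rw [mul_assoc, hmon t m hm]

/-- Completeness is invariant under automorphisms of the torus. -/
theorem transform (h : LaurentComplete S p q a b) {k₁ k₂ n₁ n₂ : ℤ}
    (hdet : k₁ * n₂ - k₂ * n₁ = 1) :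
    LaurentComplete S (fun m => k₁ * p m + k₂ * q m) (fun m => n₁ * p m + n₂ * q m)
      (fun m => n₂ * a m - n₁ * b m) (fun m => k₁ * b m - k₂ * a m) := by
  intro c₁ c₂ hc₁ hc₂
  -- The old coordinates are x = u^k₁ v^n₁ and y = u^k₂ v^n₂. Determinant 1 gives the inverse u =
  -- x^n₂ y^(-n₁), v = x^(-k₂) y^k₁.
  obtain ⟨x, y, hx0, hy0, hxy⟩ := h (c₁ ^ k₁ * c₂ ^ n₁) (c₁ ^ k₂ * c₂ ^ n₂)
    (mul_ne_zero (zpow_ne_zero _ hc₁) (zpow_ne_zero _ hc₂))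
    (mul_ne_zero (zpow_ne_zero _ hc₁) (zpow_ne_zero _ hc₂))
  have hmon : ∀ t m, (x t ^ n₂ * y t ^ (-n₁)) ^ (k₁ * p m + k₂ * q m) *
      (x t ^ (-k₂) * y t ^ k₁) ^ (n₁ * p m + n₂ * q m) = x t ^ p m * y t ^ q m := by
    intro t m
    have hx := (hxy t).1
    have hy := (hxy t).2.1
    rw [mul_zpow, mul_zpow, ← zpow_mul, ← zpow_mul, ← zpow_mul, ← zpow_mul, mul_mul_mul_comm,
      ← zpow_add₀ hx, ← zpow_add₀ hy]
    congr 2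
    · linear_combination (p m) * hdet
    · linear_combination (q m) * hdet
  have hder : ∀ (i j : ℤ) t, HasDerivAt (fun t => x t ^ i * y t ^ j) (x t ^ i * y t ^ j *
      ∑ m ∈ S, (i * a m + j * b m) * (x t ^ p m * y t ^ q m)) t := by
    intro i j t
    obtain ⟨hx, hy, hdx, hdy⟩ := hxy t
    have h1 := (hasDerivAt_zpow i (x t) (Or.inl hx)).comp t hdx
    have h2 := (hasDerivAt_zpow j (y t) (Or.inl hy)).comp t hdy
    refine (h1.mul h2).congr_deriv ?_
    simp only [Function.comp_apply]
    have e : ∑ m ∈ S, (i * a m + j * b m) * (x t ^ p m * y t ^ q m) =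
        i * ∑ m ∈ S, a m * (x t ^ p m * y t ^ q m) +
        j * ∑ m ∈ S, b m * (x t ^ p m * y t ^ q m) := by
      rw [Finset.mul_sum, Finset.mul_sum, ← Finset.sum_add_distrib]
      exact Finset.sum_congr rfl fun m _ => by ring
    rw [e, zpow_sub_one₀ hx, zpow_sub_one₀ hy]
    field_simp
  have hinit : ∀ i j : ℤ, x 0 ^ i * y 0 ^ j =
      c₁ ^ (k₁ * i + k₂ * j) * c₂ ^ (n₁ * i + n₂ * j) := by
    intro i j
    rw [hx0, hy0, mul_zpow, mul_zpow, ← zpow_mul, ← zpow_mul, ← zpow_mul, ← zpow_mul,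
      mul_mul_mul_comm, ← zpow_add₀ hc₁, ← zpow_add₀ hc₂]
  refine ⟨fun t => x t ^ n₂ * y t ^ (-n₁), fun t => x t ^ (-k₂) * y t ^ k₁, ?_, ?_, fun t =>
    ⟨mul_ne_zero (zpow_ne_zero _ (hxy t).1) (zpow_ne_zero _ (hxy t).2.1),
      mul_ne_zero (zpow_ne_zero _ (hxy t).1) (zpow_ne_zero _ (hxy t).2.1), ?_, ?_⟩⟩
  · refine (hinit _ _).trans ?_
    rw [show k₁ * n₂ + k₂ * -n₁ = 1 by linear_combination hdet,
      show n₁ * n₂ + n₂ * -n₁ = 0 by ring]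
    simp
  · refine (hinit _ _).trans ?_
    rw [show k₁ * -k₂ + k₂ * k₁ = 0 by ring,
      show n₁ * -k₂ + n₂ * k₁ = 1 by linear_combination hdet]
    simp
  · refine (hder _ _ t).congr_deriv ?_
    simp only [hmon]
    push_cast
    congr 1
    exact Finset.sum_congr rfl fun m _ => by ring
  · refine (hder _ _ t).congr_deriv ?_
    simp only [hmon]
    push_cast
    congr 1
    exact Finset.sum_congr rfl fun m _ => by ring

/-- The first equation of a complete field in which the second variable does not occur. -/
theorem fst (h : LaurentComplete S p q a b) (hq : ∀ m ∈ S, q m = 0) :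
    LaurentComplete S p q a (fun _ => 0) := by
  intro c₁ c₂ hc₁ hc₂
  obtain ⟨x, y, hx0, hy0, hxy⟩ := h c₁ c₂ hc₁ hc₂
  -- The first equation does not involve y, so y may be frozen.
  refine ⟨x, fun _ => c₂, hx0, rfl, fun t => ⟨(hxy t).1, hc₂, ?_, ?_⟩⟩
  · convert (hxy t).2.2.1 using 2
    exact Finset.sum_congr rfl fun m hm => by rw [hq m hm, zpow_zero, zpow_zero]
  · simpa using hasDerivAt_const t c₂

/-- Terms with coefficient zero can be dropped. -/
theorem filter (h : LaurentComplete S p q a b) {P : ι → Prop} [DecidablePred P]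
    (hP : ∀ m ∈ S, ¬ P m → a m = 0 ∧ b m = 0) : LaurentComplete (S.filter P) p q a b := by
  intro c₁ c₂ hc₁ hc₂
  obtain ⟨x, y, hx0, hy0, hxy⟩ := h c₁ c₂ hc₁ hc₂
  refine ⟨x, y, hx0, hy0, fun t => ⟨(hxy t).1, (hxy t).2.1, ?_, ?_⟩⟩
  · rw [Finset.sum_filter_of_ne]
    · exact (hxy t).2.2.1
    · intro m hm hne
      by_contra hn
      exact hne (by rw [(hP m hm hn).1, zero_mul])
  · rw [Finset.sum_filter_of_ne]
    · exact (hxy t).2.2.2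
    · intro m hm hne
      by_contra hn
      exact hne (by rw [(hP m hm hn).2, zero_mul])

/-! ### Blowing up at zeros of the face polynomials -/

open Polynomial in
/-- The terms of degree `d` in `x`, as a polynomial in `y` after division by `y ^ r`. -/
noncomputable def _root_.facePolynomial (S : Finset ι) (p q : ι → ℤ) (d r : ℤ) (a : ι → ℂ) :
    ℂ[X] :=
  ∑ m ∈ S with p m = d, C (a m) * X ^ (q m - r).toNat

theorem _root_.facePolynomial_eval {d r : ℤ} (hr : ∀ m ∈ S, p m = d → r ≤ q m) {w : ℂ}
    (hw : w ≠ 0) (c : ι → ℂ) :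
    ∑ m ∈ S with p m = d, c m * w ^ q m = w ^ r * (facePolynomial S p q d r c).eval w := by
  rw [facePolynomial, Polynomial.eval_finsetSum, Finset.mul_sum]
  refine Finset.sum_congr rfl fun m hm => ?_
  rw [Finset.mem_filter] at hm
  have := hr m hm.1 hm.2
  simp only [Polynomial.eval_mul, Polynomial.eval_C, Polynomial.eval_pow, Polynomial.eval_X]
  rw [mul_left_comm, ← zpow_natCast, ← zpow_add₀ hw, Int.toNat_of_nonneg (by omega)]
  congr 2; ring

open Polynomial in
theorem _root_.continuousAt_facePolynomial_add (T : Finset ι) (p q : ι → ℤ) (c : ι → ℂ)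
    (e : ι → ℕ) (A : ℂ[X]) (d r : ℤ) (n : ℕ) {β : ℂ} (hβ : β ≠ 0) {z : ℂ × ℂ} (hz : z.1 ≠ 0) :
    ContinuousAt (fun w : ℂ × (ℂ × ℂ) => w.2.1 ^ d * w.2.2 ^ n * (β + w.1 * w.2.2) ^ r *
      A.eval (β + w.1 * w.2.2) +
      ∑ m ∈ T, c m * (w.1 ^ e m * (w.2.1 ^ p m * (β + w.1 * w.2.2) ^ q m))) (0, z) := by
  have hz₁ : ∀ k : ℤ, ContinuousAt (fun w : ℂ × (ℂ × ℂ) => w.2.1 ^ k) (0, z) := fun k =>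
    ContinuousAt.zpow₀ (by fun_prop) _ (Or.inl hz)
  have hz₂ : ∀ k : ℤ, ContinuousAt (fun w : ℂ × (ℂ × ℂ) => (β + w.1 * w.2.2) ^ k) (0, z) :=
    fun k => ContinuousAt.zpow₀ (by fun_prop) _ (Or.inl (by simpa using hβ))
  have hz₃ : ContinuousAt (fun w : ℂ × (ℂ × ℂ) => A.eval (β + w.1 * w.2.2)) (0, z) :=
    (A.continuous.comp (by fun_prop : Continuous fun w : ℂ × (ℂ × ℂ) =>
      β + w.1 * w.2.2)).continuousAt
  refine ContinuousAt.add (((hz₁ d).mul (by fun_prop)).mul (hz₂ r) |>.mul hz₃) ?_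
  refine tendsto_finsetSum _ fun m _ => ?_
  exact continuousAt_const.mul ((continuousAt_fst.pow _).mul ((hz₁ _).mul (hz₂ _)))

open Polynomial in
/-- Solutions near a common zero of the face polynomials, in rescaled coordinates. -/
theorem exists_rescaled_solution (h : LaurentComplete S p q a b) {d r N : ℤ}
    (hr : ∀ m ∈ S, p m = d → r ≤ q m) {β η : ℂ} (hη : η ≠ 0) (hβη : β + η ≠ 0) (l : ℕ) {A B : ℂ[X]}
    (hA : facePolynomial S p q d r a = (X - C β) ^ l * A)
    (hB : facePolynomial S p q d r b = (X - C β) ^ (l + 1) * B) {e f : ι → ℕ}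
    (hem : ∀ m ∈ S, p m ≠ d → (e m : ℤ) = N * (d - p m) - l)
    (hfm : ∀ m ∈ S, p m ≠ d → (f m : ℤ) = N * (d - p m) - l - 1) :
    ∃ x y : ℂ → ℂ, x 0 = 1 ∧ y 0 = 1 ∧ Differentiable ℂ (fun t => x t ^ d * y t ^ (l : ℤ)) ∧
      ∀ t, HasDerivAt x (x t * (x t ^ d * y t ^ l * (β + η * y t) ^ r * A.eval (β + η * y t) +
          ∑ m ∈ S with p m ≠ d, a m * (η ^ e m * (x t ^ p m * (β + η * y t) ^ q m)))) t ∧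
        HasDerivAt y ((β + η * y t) * (x t ^ d * y t ^ (l + 1) * (β + η * y t) ^ r *
          B.eval (β + η * y t) +
          ∑ m ∈ S with p m ≠ d, b m * (η ^ f m * (x t ^ p m * (β + η * y t) ^ q m)))) t := by
  obtain ⟨x, y, hx0, hy0, hxy⟩ := h (η ^ (-N)) (β + η) (zpow_ne_zero _ hη) hβη
  -- The coordinates are η^N x and (y - β)/η. This time scale balances the factors η^(-Nd) from x^d
  -- and η^l from the zero at β.
  set σ : ℂ := η ^ (N * d - l) with hσ
  have hT : ∀ t : ℂ, HasDerivAt (fun t : ℂ => σ * t) σ t := fun t => by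
    simpa using (hasDerivAt_id t).const_mul σ
  have hx' : ∀ t, HasDerivAt (fun t => η ^ N * x (σ * t)) _ t := fun t =>
    ((hxy (σ * t)).2.2.1.comp t (hT t)).const_mul (η ^ N)
  have hy' : ∀ t, HasDerivAt (fun t => (y (σ * t) - β) / η) _ t := fun t =>
    (((hxy (σ * t)).2.2.2.comp t (hT t)).sub_const β).div_const η
  have hw : ∀ t, β + η * ((y (σ * t) - β) / η) = y (σ * t) := fun t => by
    rw [mul_comm, div_mul_cancel₀ _ hη, add_sub_cancel]
  have hxpow : ∀ t (k : ℤ), (η ^ N * x (σ * t)) ^ k = η ^ (N * k) * x (σ * t) ^ k := by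
    intro t k; rw [mul_zpow, zpow_mul]
  have hsplit : ∀ (c : ι → ℂ) t, ∑ m ∈ S, c m * (x t ^ p m * y t ^ q m) =
      x t ^ d * (y t ^ r * (facePolynomial S p q d r c).eval (y t)) +
      ∑ m ∈ S with p m ≠ d, c m * (x t ^ p m * y t ^ q m) := by
    intro c t
    rw [← Finset.sum_filter_add_sum_filter_not S (fun m => p m = d),
      ← facePolynomial_eval hr (hxy t).2.1, Finset.mul_sum]
    congr 1
    refine Finset.sum_congr rfl fun m hm => ?_
    rw [(Finset.mem_filter.1 hm).2]; ring
  refine ⟨fun t => η ^ N * x (σ * t), fun t => (y (σ * t) - β) / η, ?_, ?_, ?_, ?_⟩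
  · simp [hx0, zpow_ne_zero _ hη]
  · simp [hy0, hη]
  · intro t
    -- The coordinate (y - β)/η may vanish, so differentiability relies on the exponent l being a
    -- natural number.
    simp only [zpow_natCast]
    exact ((hx' t).differentiableAt.zpow (Or.inl (mul_ne_zero (zpow_ne_zero _ hη)
      (hxy _).1))).mul ((hy' t).differentiableAt.pow l)
  · intro t
    refine ⟨(hx' t).congr_deriv ?_, (hy' t).congr_deriv ?_⟩
    · simp only [hw]
      rw [hsplit, hA, eval_mul, eval_pow, eval_sub, eval_X, eval_C, mul_assoc (x _),
        ← mul_assoc (η ^ N), add_mul, Finset.sum_mul]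
      congr 2
      · rw [hxpow]
        generalize σ * t = T
        rw [hσ, zpow_sub₀ hη, zpow_natCast, div_pow]
        field_simp
      · refine Finset.sum_congr rfl fun m hm => ?_
        rw [Finset.mem_filter] at hm
        rw [hxpow, ← zpow_natCast η (e m), hem m hm.1 hm.2, hσ,
          show N * d - l = (N * (d - p m) - l) + N * p m by ring, zpow_add₀ hη]
        ring
    · simp only [hw]
      rw [hsplit, hB, eval_mul, eval_pow, eval_sub, eval_X, eval_C, mul_assoc (y _), mul_div_assoc,
        add_mul, Finset.sum_mul, add_div, Finset.sum_div]
      congr 2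
      · rw [hxpow]
        generalize σ * t = T
        rw [hσ, zpow_sub₀ hη, zpow_natCast, div_pow, pow_succ η]
        field_simp
      · refine Finset.sum_congr rfl fun m hm => ?_
        rw [Finset.mem_filter] at hm
        rw [hxpow, ← zpow_natCast η (f m), hfm m hm.1 hm.2, hσ,
          show N * d - l = (N * (d - p m) - l - 1) + N * p m + 1 by ring, zpow_add₀ hη,
          zpow_add₀ hη, zpow_one]
        field_simp

open Polynomial in
/-- The condition on a complete field at a common zero of its two face polynomials. -/
theorem face_root (h : LaurentComplete S p q a b) {d r : ℤ} (hd : ∀ m ∈ S, p m ≤ d)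
    (hr : ∀ m ∈ S, p m = d → r ≤ q m) {β : ℂ} (hβ : β ≠ 0) (l : ℕ) {A B : ℂ[X]}
    (hA : facePolynomial S p q d r a = (X - C β) ^ l * A)
    (hB : facePolynomial S p q d r b = (X - C β) ^ (l + 1) * B) :
    d * A.eval β + l * (β * B.eval β) = 0 := by
  classical
  -- Off the face d - p m ≥ 1, so N = l + 2 makes even the smaller exponent N(d - p m) - l - 1
  -- positive.
  set N : ℤ := l + 2 with hN
  set e : ι → ℕ := fun m => (N * (d - p m) - l).toNat with he
  set f : ι → ℕ := fun m => (N * (d - p m) - l - 1).toNat with hf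
  have hpos : ∀ m ∈ S, p m ≠ d → N ≤ N * (d - p m) := by
    intro m hm hne
    have := hd m hm
    have h1 : 1 ≤ d - p m := by omega
    nlinarith
  have hem : ∀ m ∈ S, p m ≠ d → (e m : ℤ) = N * (d - p m) - l := by
    intro m hm hne
    have := hpos m hm hne
    simp only [he]; rw [Int.toNat_of_nonneg (by omega)]
  have hfm : ∀ m ∈ S, p m ≠ d → (f m : ℤ) = N * (d - p m) - l - 1 := by
    intro m hm hne
    have := hpos m hm hne
    simp only [hf]; rw [Int.toNat_of_nonneg (by omega)]
  have hres := resonance_of_family (l₁ := β ^ r * A.eval β) (l₂ := β ^ r * (β * B.eval β))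
    (m₁ := d) (m₂ := l)
    (fun η z => z.1 * (z.1 ^ d * z.2 ^ l * (β + η * z.2) ^ r * A.eval (β + η * z.2) +
      ∑ m ∈ S with p m ≠ d, a m * (η ^ e m * (z.1 ^ p m * (β + η * z.2) ^ q m))))
    (fun η z => (β + η * z.2) * (z.1 ^ d * z.2 ^ (l + 1) * (β + η * z.2) ^ r *
        B.eval (β + η * z.2) +
      ∑ m ∈ S with p m ≠ d, b m * (η ^ f m * (z.1 ^ p m * (β + η * z.2) ^ q m))))
    ?_ ?_ ?_ ?_ ?_
  · have h1 : β ^ r ≠ 0 := zpow_ne_zero _ hβ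
    refine (mul_eq_zero.1 (?_ : β ^ r * _ = 0)).resolve_left h1
    rw [← hres]; push_cast; ring
  · intro z h1 _
    exact ContinuousAt.mul (by fun_prop) (continuousAt_facePolynomial_add _ p q a e A d r l hβ h1)
  · intro z h1 _
    exact ContinuousAt.mul (by fun_prop)
      (continuousAt_facePolynomial_add _ p q b f B d r (l + 1) hβ h1)
  · intro z _ _
    have : ∑ m ∈ S with p m ≠ d, a m * ((0 : ℂ) ^ e m * (z.1 ^ p m * (β + 0 * z.2) ^ q m)) = 0 := by
      refine Finset.sum_eq_zero fun m hm => ?_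
      rw [Finset.mem_filter] at hm
      have h1 := hem m hm.1 hm.2
      have h2 := hpos m hm.1 hm.2
      rw [zero_pow (by omega)]; ring
    rw [this]
    simp only [zero_mul, add_zero, zpow_natCast]; ring
  · intro z _ _
    have : ∑ m ∈ S with p m ≠ d, b m * ((0 : ℂ) ^ f m * (z.1 ^ p m * (β + 0 * z.2) ^ q m)) = 0 := by
      refine Finset.sum_eq_zero fun m hm => ?_
      rw [Finset.mem_filter] at hm
      have h1 := hfm m hm.1 hm.2
      have h2 := hpos m hm.1 hm.2
      rw [zero_pow (by omega)]; ring
    rw [this]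
    simp only [zero_mul, add_zero, zpow_natCast]; ring
  · have hnhds : ∀ᶠ η in nhdsWithin (0 : ℂ) {0}ᶜ, β + η ≠ 0 := by
      refine Filter.Eventually.filter_mono nhdsWithin_le_nhds ?_
      have hc : ContinuousAt (fun η : ℂ => β + η) 0 := by fun_prop
      exact hc.eventually_ne (by simpa using hβ)
    filter_upwards [self_mem_nhdsWithin, hnhds] with η hη hβη
    exact exists_rescaled_solution h hr hη hβη l hA hB hem hfm

end LaurentComplete

/-! ### Residues exclude edges off the origin -/

open Polynomial in
/-- The polynomial identity that excludes faces of positive length: the order of `A` at the roots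
of `B` and its behaviour at `0` and `∞` contradict the residue theorem. -/
theorem Polynomial.not_forall_root_relation {A B : ℂ[X]} {d r : ℂ} (hd : d ≠ 0)
    (hB0 : B.coeff 0 ≠ 0) (hK : 0 < B.natDegree) (hA : A.natDegree ≤ B.natDegree)
    (h0 : d * A.coeff 0 + r * B.coeff 0 = 0)
    (h1 : d * A.coeff B.natDegree + (r + B.natDegree) * B.coeff B.natDegree = 0) :
    ¬ ∀ β : ℂ, β ≠ 0 → ∀ (l : ℕ) (A' B' : ℂ[X]), A = (X - C β) ^ l * A' →
      B = (X - C β) ^ (l + 1) * B' → d * A'.eval β + l * (β * B'.eval β) = 0 := by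
  intro hroot
  classical
  have hBne : B ≠ 0 := by rintro rfl; simp at hK
  have hsplits : B.Splits := IsAlgClosed.splits B
  set Z : Finset ℂ := B.roots.toFinset with hZ
  have hZroot : ∀ β, β ∈ Z ↔ B.IsRoot β := by
    intro β; rw [hZ, Multiset.mem_toFinset, mem_roots hBne]
  have hne : ∀ β ∈ Z, β ≠ 0 := by
    rintro β hβ rfl
    rw [hZroot, IsRoot.def, ← coeff_zero_eq_eval_zero] at hβ
    exact hB0 hβ
  have hmult : ∀ β ∈ Z, 0 < B.rootMultiplicity β := fun β hβ =>
    (rootMultiplicity_pos hBne).2 ((hZroot β).1 hβ)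
  -- Below the full multiplicity the cofactor of B vanishes at β, so the relation reduces to d·A'(β)
  -- = 0 and A gains another factor.
  have hAdvd : ∀ β ∈ Z, ∀ l < B.rootMultiplicity β, (X - C β) ^ l ∣ A := by
    intro β hβ l
    induction l with
    | zero => intro _; simp
    | succ l ih =>
      intro hl
      obtain ⟨A', hA'⟩ := ih (by omega)
      obtain ⟨B', hB'⟩ := (le_rootMultiplicity_iff hBne).1 (show l + 1 + 1 ≤ _ from hl)
      have := hroot β (hne β hβ) l A' ((X - C β) * B') hA' (by rw [hB']; ring)
      simp only [eval_mul, eval_sub, eval_X, eval_C, sub_self, zero_mul, mul_zero, add_zero,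
        mul_eq_zero, hd, false_or] at this
      obtain ⟨A'', hA''⟩ := dvd_iff_isRoot.2 (show A'.IsRoot β from this)
      exact ⟨A'', by rw [hA', hA'']; ring⟩
  have hDex : ∀ β, ∃ D : ℂ[X], β ∈ Z → B = (X - C β) * D := by
    intro β
    by_cases hβ : β ∈ Z
    · obtain ⟨D, hD⟩ := dvd_iff_isRoot.2 ((hZroot β).1 hβ)
      exact ⟨D, fun _ => hD⟩
    · exact ⟨0, fun h => absurd h hβ⟩
  choose D hD using hDex
  -- With μ the multiplicity of β in B, E/(XB) = dA/(XB) + r/X + Σ (μ - 1)/(X - β). The added terms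
  -- cancel the residues -r at 0 and -(μ - 1) at β.
  set E : ℂ[X] := C d * A + C r * B +
    X * ∑ β ∈ Z, C ((B.rootMultiplicity β : ℂ) - 1) * D β with hE
  have hcop : ∀ β γ : ℂ, β ≠ γ → IsCoprime (X - C β) (X - C γ) := fun β γ h =>
    isCoprime_X_sub_C_of_isUnit_sub (sub_ne_zero.2 h).isUnit
  have hdvd : ∀ β ∈ Z, (X - C β) ^ B.rootMultiplicity β ∣ E := by
    intro β hβ
    obtain ⟨l, hl⟩ : ∃ l, B.rootMultiplicity β = l + 1 :=
      ⟨_, (Nat.succ_pred_eq_of_pos (hmult β hβ)).symm⟩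
    obtain ⟨A', hA'⟩ := hAdvd β hβ l (by omega)
    obtain ⟨B', hB'⟩ : (X - C β) ^ (l + 1) ∣ B := hl ▸ pow_rootMultiplicity_dvd B β
    have hDβ : D β = (X - C β) ^ l * B' := by
      refine mul_left_cancel₀ (X_sub_C_ne_zero β) ?_
      rw [← hD β hβ, hB']; ring
    have hother : (X - C β) ^ (l + 1) ∣
        ∑ γ ∈ Z.erase β, C ((B.rootMultiplicity γ : ℂ) - 1) * D γ := by
      refine Finset.dvd_sum fun γ hγ => Dvd.dvd.mul_left ?_ _
      rw [Finset.mem_erase] at hγ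
      refine IsCoprime.dvd_of_dvd_mul_left
        (IsCoprime.pow_left (hcop β γ hγ.1.symm)) (?_ : _ ∣ (X - C γ) * D γ)
      rw [← hD γ hγ.2]; exact ⟨B', hB'⟩
    have hmain : (X - C β) ^ (l + 1) ∣ C d * A + X * (C (l : ℂ) * D β) := by
      have hr : (X - C β) ∣ C d * A' + X * (C (l : ℂ) * B') := by
        rw [dvd_iff_isRoot, IsRoot.def]
        simp only [eval_add, eval_mul, eval_C, eval_X]
        rw [← hroot β (hne β hβ) l A' B' hA' hB']; ring
      obtain ⟨G, hG⟩ := hr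
      refine ⟨G, ?_⟩
      rw [hDβ, hA', pow_succ, mul_assoc, ← hG]; ring
    have hEeq : E = (C d * A + X * (C (l : ℂ) * D β)) + C r * B +
        X * ∑ γ ∈ Z.erase β, C ((B.rootMultiplicity γ : ℂ) - 1) * D γ := by
      rw [hE, ← Finset.add_sum_erase Z _ hβ, hl]
      push_cast
      rw [add_sub_cancel_right]; ring
    rw [hl, hEeq]
    exact dvd_add (dvd_add hmain (Dvd.dvd.mul_left ⟨B', hB'⟩ _)) (Dvd.dvd.mul_left hother _)
  have hprod : B = C B.leadingCoeff * ∏ β ∈ Z, (X - C β) ^ B.rootMultiplicity β := by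
    conv_lhs => rw [hsplits.eq_prod_roots, prod_multiset_root_eq_finset_root]
  have hBE : B ∣ E := by
    rw [hprod]
    refine (isUnit_C.2 (leadingCoeff_ne_zero.2 hBne).isUnit).mul_left_dvd.2 ?_
    exact Finset.prod_dvd_of_coprime (fun β _ γ _ hne => (hcop β γ hne).pow) hdvd
  have hDdeg : ∀ β ∈ Z, (D β).natDegree + 1 = B.natDegree := by
    intro β hβ
    have hDne : D β ≠ 0 := by
      intro h0; exact hBne (by rw [hD β hβ, h0, mul_zero])
    conv_rhs => rw [hD β hβ, natDegree_mul (X_sub_C_ne_zero β) hDne, natDegree_X_sub_C]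
    ring
  have hDlead : ∀ β ∈ Z, (D β).coeff (B.natDegree - 1) = B.coeff B.natDegree := by
    intro β hβ
    have h2 : (D β).natDegree = B.natDegree - 1 := by have := hDdeg β hβ; omega
    rw [← h2]
    change (D β).leadingCoeff = B.leadingCoeff
    conv_rhs => rw [hD β hβ, leadingCoeff_mul, leadingCoeff_X_sub_C, one_mul]
  have hEdeg : E.natDegree ≤ B.natDegree := by
    refine natDegree_add_le_of_degree_le (natDegree_add_le_of_degree_le
      ((natDegree_C_mul_le _ _).trans hA) (natDegree_C_mul_le _ _)) ?_
    rw [Finset.mul_sum]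
    refine natDegree_sum_le_of_forall_le _ _ fun β hβ => ?_
    refine natDegree_mul_le.trans ?_
    have := natDegree_C_mul_le ((B.rootMultiplicity β : ℂ) - 1) (D β)
    have := hDdeg β hβ
    rw [natDegree_X]; omega
  have hE0 : E.coeff 0 = 0 := by simp [hE, h0]
  -- E is a constant multiple of B by degree, and E(0) = 0 while B(0) ≠ 0.
  have hEzero : E = 0 := by
    obtain ⟨G, hG⟩ := hBE
    by_contra hEne
    have hGne : G ≠ 0 := by rintro rfl; exact hEne (by rw [hG, mul_zero])
    have hdeg := hEdeg
    rw [hG, natDegree_mul hBne hGne] at hdeg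
    have hG0 := natDegree_eq_zero.1 (show G.natDegree = 0 by omega)
    obtain ⟨g, rfl⟩ := hG0
    rw [hG, coeff_mul_C, mul_eq_zero] at hE0
    rcases hE0 with h | h
    · exact hB0 h
    · exact hGne (by rw [h, C_0])
  have hcoeff : E.coeff B.natDegree = d * A.coeff B.natDegree + r * B.coeff B.natDegree +
      ∑ β ∈ Z, ((B.rootMultiplicity β : ℂ) - 1) * B.coeff B.natDegree := by
    obtain ⟨k, hk⟩ : ∃ k, B.natDegree = k + 1 := ⟨_, (Nat.succ_pred_eq_of_pos hK).symm⟩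
    rw [hE, hk]
    simp only [coeff_add, coeff_C_mul, coeff_X_mul, finsetSum_coeff]
    congr 1
    refine Finset.sum_congr rfl fun β hβ => ?_
    rw [← hk, ← hDlead β hβ, hk, Nat.add_sub_cancel]
  have hcard : ∑ β ∈ Z, B.rootMultiplicity β = B.natDegree := by
    rw [hsplits.natDegree_eq_card_roots, ← Multiset.toFinset_sum_count_eq]
    simp [hZ]
  have hZne : Z.Nonempty := by
    by_contra hcon
    rw [Finset.not_nonempty_iff_eq_empty] at hcon
    rw [hcon, Finset.sum_empty] at hcard
    omega
  rw [hEzero, coeff_zero, ← Finset.sum_mul, Finset.sum_sub_distrib, ← Nat.cast_sum, hcard] at hcoeff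
  -- In the top coefficient Σ (μ - 1) = deg B - |Z|, and `h1` cancels all but the number of distinct
  -- roots.
  have hfin : (Z.card : ℂ) * B.coeff B.natDegree = 0 := by
    simp only [Finset.sum_const, nsmul_eq_mul, mul_one] at hcoeff
    linear_combination hcoeff + h1
  rw [mul_eq_zero] at hfin
  rcases hfin with h | h
  · rw [Nat.cast_eq_zero, Finset.card_eq_zero] at h
    exact hZne.ne_empty h
  · exact hBne (leadingCoeff_eq_zero.1 h)

/-! ### Vertices at the ends of a face -/

namespace LaurentComplete

variable {ι : Type*} {S : Finset ι} {p q : ι → ℤ} {a b : ι → ℂ}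

theorem _root_.facePolynomial_natDegree_le {d r : ℤ} {K : ℕ}
    (hK : ∀ m ∈ S, p m = d → q m ≤ r + K) (c : ι → ℂ) :
    (facePolynomial S p q d r c).natDegree ≤ K := by
  refine Polynomial.natDegree_sum_le_of_forall_le _ _ fun m hm => ?_
  rw [Finset.mem_filter] at hm
  have := hK m hm.1 hm.2
  exact (Polynomial.natDegree_C_mul_X_pow_le _ _).trans (by omega)

theorem _root_.facePolynomial_coeff {d r : ℤ} (hr : ∀ m ∈ S, p m = d → r ≤ q m)
    (hinj : ∀ m ∈ S, ∀ n ∈ S, p m = p n → q m = q n → m = n) (c : ι → ℂ) {v : ι} (hv : v ∈ S)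
    (hvd : p v = d) {k : ℕ} (hk : q v = r + k) : (facePolynomial S p q d r c).coeff k = c v := by
  classical
  rw [facePolynomial, Polynomial.finsetSum_coeff,
    Finset.sum_eq_single_of_mem v (Finset.mem_filter.2 ⟨hv, hvd⟩)]
  · rw [Polynomial.coeff_C_mul_X_pow, if_pos (by omega)]
  · intro m hm hne
    rw [Finset.mem_filter] at hm
    have h1 := hr m hm.1 hm.2
    rw [Polynomial.coeff_C_mul_X_pow, if_neg]
    intro h
    exact hne (hinj m hm.1 v hv (hm.2.trans hvd.symm) (by omega))

/-- A face of the Newton polygon of a complete field off the origin is a vertex. -/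
theorem face_subsingleton (h : LaurentComplete S p q a b)
    (hinj : ∀ m ∈ S, ∀ n ∈ S, p m = p n → q m = q n → m = n)
    (hsupp : ∀ m ∈ S, a m ≠ 0 ∨ b m ≠ 0) {d : ℤ} (hd0 : d ≠ 0) (hd : ∀ m ∈ S, p m ≤ d) {m n : ι}
    (hm : m ∈ S) (hn : n ∈ S) (hpm : p m = d) (hpn : p n = d) : m = n := by
  classical
  have hF : (S.filter fun m => p m = d).Nonempty := ⟨m, Finset.mem_filter.2 ⟨hm, hpm⟩⟩
  obtain ⟨v₀, hv₀, hmin⟩ := Finset.exists_min_image _ q hF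
  obtain ⟨v₁, hv₁, hmax⟩ := Finset.exists_max_image _ q hF
  simp only [Finset.mem_filter, and_imp] at hv₀ hv₁ hmin hmax
  by_contra hmn
  have hlt : q v₀ < q v₁ := by
    have h1 := hmin m hm hpm
    have h2 := hmax m hm hpm
    have h3 := hmin n hn hpn
    have h4 := hmax n hn hpn
    by_contra hcon
    exact hmn (hinj m hm n hn (hpm.trans hpn.symm) (by omega))
  -- Large enough for the weights (N, ∓1) to single out the lower and upper end of the face p = d.
  set N : ℤ := 1 + 2 * ∑ m ∈ S, |q m| with hN
  have habs : ∀ m ∈ S, |q m| ≤ ∑ m ∈ S, |q m| := fun m hm =>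
    Finset.single_le_sum (f := fun m => |q m|) (fun _ _ => abs_nonneg _) hm
  have hbig : ∀ m ∈ S, ∀ v ∈ S, p m ≠ d → N * p m + |q m| < N * d - |q v| := by
    intro m hm v hv hne
    have h1 := habs m hm
    have h2 := habs v hv
    have h3 := hd m hm
    have h4 : 1 ≤ d - p m := by omega
    have h5 : 0 ≤ ∑ m ∈ S, |q m| := (abs_nonneg _).trans h1
    nlinarith
  have e₀ := h.vertex N (-1) hv₀.1 (by
    intro m hm hne
    rw [hv₀.2]
    by_cases hp : p m = d
    · have h1 := hmin m hm hp
      have h2 : q m ≠ q v₀ := fun h2 => hne (hinj m hm v₀ hv₀.1 (hp.trans hv₀.2.symm) h2)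
      rw [hp]; omega
    · have := hbig m hm v₀ hv₀.1 hp
      have := neg_abs_le (q m)
      have := le_abs_self (q v₀)
      linarith)
  have e₁ := h.vertex N 1 hv₁.1 (by
    intro m hm hne
    rw [hv₁.2]
    by_cases hp : p m = d
    · have h1 := hmax m hm hp
      have h2 : q m ≠ q v₁ := fun h2 => hne (hinj m hm v₁ hv₁.1 (hp.trans hv₁.2.symm) h2)
      rw [hp]; omega
    · have := hbig m hm v₁ hv₁.1 hp
      have := le_abs_self (q m)
      have := neg_abs_le (q v₁)
      linarith)
  rw [hv₀.2] at e₀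
  rw [hv₁.2] at e₁
  have hdC : (d : ℂ) ≠ 0 := Int.cast_ne_zero.2 hd0
  -- Since d ≠ 0, the vertex relation with b = 0 would also give a = 0.
  have hbne : ∀ v ∈ S, (d : ℂ) * a v + q v * b v = 0 → b v ≠ 0 := by
    intro v hv he hb
    rw [hb, mul_zero, add_zero, mul_eq_zero] at he
    exact (hsupp v hv).elim (fun h => h (he.resolve_left hdC)) (fun h => h hb)
  obtain ⟨K, hK⟩ : ∃ K : ℕ, q v₁ = q v₀ + K :=
    ⟨(q v₁ - q v₀).toNat, by rw [Int.toNat_of_nonneg (by omega)]; ring⟩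
  have hdegle : ∀ c, (facePolynomial S p q d (q v₀) c).natDegree ≤ K :=
    facePolynomial_natDegree_le fun m hm hp => hK ▸ hmax m hm hp
  have hc₀ : ∀ c, (facePolynomial S p q d (q v₀) c).coeff 0 = c v₀ := fun c =>
    facePolynomial_coeff hmin hinj c hv₀.1 hv₀.2 (by simp)
  have hc₁ : ∀ c, (facePolynomial S p q d (q v₀) c).coeff K = c v₁ := fun c =>
    facePolynomial_coeff hmin hinj c hv₁.1 hv₁.2 hK
  have hdeg : (facePolynomial S p q d (q v₀) b).natDegree = K :=
    Polynomial.natDegree_eq_of_le_of_coeff_ne_zero (hdegle b)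
      (by rw [hc₁]; exact hbne v₁ hv₁.1 e₁)
  refine Polynomial.not_forall_root_relation (A := facePolynomial S p q d (q v₀) a)
    (B := facePolynomial S p q d (q v₀) b) (d := d) (r := q v₀) hdC ?_ ?_ ?_ ?_ ?_ ?_
  · rw [hc₀]; exact hbne v₀ hv₀.1 e₀
  · rw [hdeg]; omega
  · rw [hdeg]; exact hdegle a
  · rw [hc₀, hc₀]; exact e₀
  · rw [hdeg, hc₁, hc₁, ← e₁, hK]; push_cast; ring
  · intro β hβ l A' B' hA' hB'
    exact h.face_root hd hmin hβ l hA' hB'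

end LaurentComplete

/-! ### The exponents lie on a line through the origin -/

theorem Int.exists_primitive {a b : ℤ} (h : a ≠ 0 ∨ b ≠ 0) :
    ∃ g k₁ k₂ n₁ n₂ : ℤ, 0 < g ∧ a = g * k₁ ∧ b = g * k₂ ∧ k₁ * n₂ - k₂ * n₁ = 1 := by
  have hg : 0 < Int.gcd a b := Int.gcd_pos_iff.2 h
  obtain ⟨k₁, k₂, hk, h1, h2⟩ := Int.exists_gcd_one hg
  obtain ⟨u, v, huv⟩ := Int.isCoprime_iff_gcd_eq_one.2 hk
  exact ⟨Int.gcd a b, k₁, k₂, -v, u, by exact_mod_cast hg, by linarith, by linarith, by linarith⟩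

/-- A finite planar set that is not contained in a line through the origin has a supporting line
that contains two points and not the origin. -/
theorem exists_edge {ι : Type*} {S : Finset ι} {p q : ι → ℤ} {m n : ι} (hm : m ∈ S) (hn : n ∈ S)
    (hmn : p m * q n - q m * p n ≠ 0) :
    ∃ k₁ k₂ : ℤ, ∃ v ∈ S, ∃ w ∈ S, v ≠ w ∧ 0 < k₁ * p v + k₂ * q v ∧
      k₁ * p w + k₂ * q w = k₁ * p v + k₂ * q v ∧
      ∀ x ∈ S, k₁ * p x + k₂ * q x ≤ k₁ * p v + k₂ * q v := by
  classical
  obtain ⟨s, t, hst⟩ : ∃ s t : ℤ, 0 < s * p m + t * q m := by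
    refine ⟨p m, q m, ?_⟩
    have : p m ≠ 0 ∨ q m ≠ 0 := by
      by_contra! h
      exact hmn (by rw [h.1, h.2]; ring)
    rcases this with h | h <;> nlinarith [mul_self_pos.2 h, mul_self_nonneg (p m), mul_self_nonneg (q m)]
  obtain ⟨v, hv, hmax⟩ := Finset.exists_max_image S (fun x => s * p x + t * q x) ⟨m, hm⟩
  have hv0 : 0 < s * p v + t * q v := hst.trans_le (hmax m hm)
  obtain ⟨x, hx, hdet⟩ : ∃ x ∈ S, p v * q x - q v * p x ≠ 0 := by
    by_contra! h
    have h1 := h m hm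
    have h2 := h n hn
    have h3 : (p m * q n - q m * p n) * (s * p v + t * q v) = 0 := by
      linear_combination (s * p m + t * q m) * h2 - (s * p n + t * q n) * h1
    exact (mul_ne_zero hmn hv0.ne') h3
  obtain ⟨σ, hσ⟩ : ∃ σ : ℤ, 0 < σ * (p v * q x - q v * p x) :=
    ⟨_, mul_self_pos.2 hdet⟩
  set δ : ι → ℤ := fun x => σ * (p v * q x - q v * p x) with hδ
  set g : ι → ℤ := fun x => (s * p v + t * q v) - (s * p x + t * q x) with hg
  have hg0 : ∀ x ∈ S, 0 ≤ g x := fun x hx => sub_nonneg.2 (hmax x hx)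
  -- Rotate the supporting line about v, towards the side δ > 0, until it first meets another point
  -- w; g/δ measures the rotation needed.
  obtain ⟨w, hw, hmin⟩ := Finset.exists_min_image (S.filter fun x => 0 < δ x)
    (fun x => (g x : ℚ) / δ x) ⟨x, Finset.mem_filter.2 ⟨hx, hσ⟩⟩
  rw [Finset.mem_filter] at hw
  have hform : ∀ x, (δ w * s - g w * σ * q v) * p x + (δ w * t + g w * σ * p v) * q x =
      δ w * (s * p x + t * q x) + g w * δ x := by
    intro x; simp only [hδ]; ring
  have hδv : δ v = 0 := by simp only [hδ]; ring
  refine ⟨δ w * s - g w * σ * q v, δ w * t + g w * σ * p v, v, hv, w, hw.1, ?_, ?_, ?_, ?_⟩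
  · rintro rfl
    exact absurd hw.2 (by rw [hδv]; exact lt_irrefl _)
  · rw [hform, hδv, mul_zero, add_zero]
    exact mul_pos hw.2 hv0
  · rw [hform, hform, hδv]; simp only [hg]; ring
  · intro x hx
    rw [hform, hform, hδv, mul_zero, add_zero]
    have h1 : s * p x + t * q x = (s * p v + t * q v) - g x := by simp only [hg]; ring
    have hw0 := hg0 w hw.1
    have hx0 := hg0 x hx
    have h2 : g w * δ x ≤ δ w * g x := by
      by_cases hδx : 0 < δ x
      · have := hmin x (Finset.mem_filter.2 ⟨hx, hδx⟩)
        rw [div_le_div_iff₀ (by exact_mod_cast hw.2) (by exact_mod_cast hδx)] at this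
        have h3 : g w * δ x ≤ g x * δ w := by exact_mod_cast this
        linarith
      · have h3 : g w * δ x ≤ 0 := mul_nonpos_of_nonneg_of_nonpos hw0 (not_lt.1 hδx)
        have h4 : 0 ≤ δ w * g x := mul_nonneg hw.2.le hx0
        linarith
    rw [h1]; linarith

namespace LaurentComplete

variable {ι : Type*} {S : Finset ι} {p q : ι → ℤ} {a b : ι → ℂ}

/-- The Newton polygon of a complete field is contained in a line through the origin. -/
theorem collinear (h : LaurentComplete S p q a b)
    (hinj : ∀ m ∈ S, ∀ n ∈ S, p m = p n → q m = q n → m = n)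
    (hsupp : ∀ m ∈ S, a m ≠ 0 ∨ b m ≠ 0) {m n : ι} (hm : m ∈ S) (hn : n ∈ S) :
    p m * q n - q m * p n = 0 := by
  by_contra hmn
  obtain ⟨l₁, l₂, v, hv, w, hw, hvw, hpos, heq, hmax⟩ := exists_edge hm hn hmn
  obtain ⟨g, k₁, k₂, n₁, n₂, hg, rfl, rfl, hdet⟩ := Int.exists_primitive (a := l₁) (b := l₂) (by
    by_contra! h0
    rw [h0.1, h0.2] at hpos
    simp at hpos)
  have hfac : ∀ x, g * k₁ * p x + g * k₂ * q x = g * (k₁ * p x + k₂ * q x) := fun x => by ring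
  simp only [hfac] at hpos heq hmax
  have hdetC : (k₁ : ℂ) * n₂ - k₂ * n₁ = 1 := by exact_mod_cast hdet
  -- In these monomial coordinates the edge is the face on which the first exponent is maximal.
  refine hvw ((h.transform hdet).face_subsingleton ?_ ?_ (d := k₁ * p v + k₂ * q v)
    (pos_of_mul_pos_right hpos hg.le).ne' (fun x hx => le_of_mul_le_mul_left (hmax x hx) hg) hv hw
    rfl (mul_left_cancel₀ hg.ne' heq))
  · intro x hx y hy h1 h2
    refine hinj x hx y hy ?_ ?_
    · linear_combination n₂ * h1 - k₂ * h2 - (p x - p y) * hdet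
    · linear_combination k₁ * h2 - n₁ * h1 - (q x - q y) * hdet
  · intro x hx
    by_contra! h0
    have ha : a x = 0 := by linear_combination k₁ * h0.1 + n₁ * h0.2 - a x * hdetC
    have hb : b x = 0 := by linear_combination k₂ * h0.1 + n₂ * h0.2 - b x * hdetC
    exact (hsupp x hx).elim (fun h => h ha) (fun h => h hb)

/-- A complete field in one variable is linear. -/
theorem eq_zero_of_snd_eq_zero (h : LaurentComplete S p q a b) (hq : ∀ m ∈ S, q m = 0)
    (hinj : ∀ m ∈ S, ∀ n ∈ S, p m = p n → m = n) {m : ι} (hm : m ∈ S) (hpm : p m ≠ 0) :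
    a m = 0 := by
  classical
  by_contra ham
  have h' := (h.fst hq).filter (P := fun m => a m ≠ 0) fun m _ h => ⟨not_not.1 h, rfl⟩
  have hm' : m ∈ S.filter fun m => a m ≠ 0 := Finset.mem_filter.2 ⟨hm, ham⟩
  -- The factor p m selects the end of the exponent interval on the side of m, hence a nonzero one.
  obtain ⟨v, hv, hmax⟩ := Finset.exists_max_image _ (fun x => p m * p x) ⟨m, hm'⟩
  have hpos : 0 < p m * p v := (mul_self_pos.2 hpm).trans_le (hmax m hm')
  have hpv : p v ≠ 0 := by rintro h0; rw [h0, mul_zero] at hpos; exact lt_irrefl _ hpos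
  have := h'.vertex (p m) 0 hv (by
    intro x hx hne
    refine lt_of_le_of_ne ?_ ?_
    · simpa using hmax x hx
    · intro heq
      simp only [zero_mul, add_zero] at heq
      exact hne (hinj x (Finset.mem_filter.1 hx).1 v (Finset.mem_filter.1 hv).1
        (mul_left_cancel₀ hpm heq)))
  simp only [mul_zero, add_zero, mul_eq_zero, Int.cast_eq_zero] at this
  exact this.elim hpv (Finset.mem_filter.1 hv).2

/-- The structure of complete Laurent polynomial fields. -/
theorem exists_direction (h : LaurentComplete S p q a b)
    (hinj : ∀ m ∈ S, ∀ n ∈ S, p m = p n → q m = q n → m = n) :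
    ∃ k₁ k₂ : ℤ, (k₁ ≠ 0 ∨ k₂ ≠ 0) ∧ ∀ m ∈ S, (a m ≠ 0 ∨ b m ≠ 0) → (p m ≠ 0 ∨ q m ≠ 0) →
      k₁ * a m + k₂ * b m = 0 ∧ ∃ j : ℤ, p m = j * k₁ ∧ q m = j * k₂ := by
  classical
  have h' := h.filter (P := fun m => a m ≠ 0 ∨ b m ≠ 0) fun m _ h => by
    push Not at h; exact h
  set T := S.filter fun m => a m ≠ 0 ∨ b m ≠ 0 with hT
  have hinjT : ∀ m ∈ T, ∀ n ∈ T, p m = p n → q m = q n → m = n := fun m hm n hn =>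
    hinj m (Finset.mem_filter.1 hm).1 n (Finset.mem_filter.1 hn).1
  by_cases hex : ∃ m ∈ T, p m ≠ 0 ∨ q m ≠ 0
  · obtain ⟨m₀, hm₀, hne⟩ := hex
    obtain ⟨g, k₁, k₂, n₁, n₂, hg, hp, hq, hdet⟩ := Int.exists_primitive hne
    have hline : ∀ n ∈ T, k₁ * q n - k₂ * p n = 0 := by
      intro n hn
      have := h'.collinear hinjT (fun m hm => (Finset.mem_filter.1 hm).2) hm₀ hn
      rw [hp, hq] at this
      have h2 : g * (k₁ * q n - k₂ * p n) = 0 := by linear_combination this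
      exact (mul_eq_zero.1 h2).resolve_left hg.ne'
    have hj : ∀ n ∈ T, p n = (n₂ * p n - n₁ * q n) * k₁ ∧ q n = (n₂ * p n - n₁ * q n) * k₂ := by
      intro n hn
      have := hline n hn
      constructor
      · linear_combination n₁ * this - p n * hdet
      · linear_combination n₂ * this - q n * hdet
    refine ⟨k₁, k₂, ?_, ?_⟩
    · by_contra! h0
      rw [h0.1, h0.2] at hdet
      simp at hdet
    · intro m hm hab hpq
      have hmT : m ∈ T := Finset.mem_filter.2 ⟨hm, hab⟩
      refine ⟨?_, _, hj m hmT⟩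
      -- The first new coordinate is x^k₁ y^k₂, with coefficients k₁a + k₂b; the second new exponent
      -- vanishes on the line.
      have htr := h'.transform (k₁ := n₂) (k₂ := -n₁) (n₁ := -k₂) (n₂ := k₁)
        (by linear_combination hdet)
      have := htr.eq_zero_of_snd_eq_zero (m := m)
        (fun n hn => by linear_combination hline n hn) ?_ hmT ?_
      · push_cast at this
        linear_combination this
      · intro x hx y hy hxy
        have h1 := hj x hx
        have h2 := hj y hy
        have h3 : n₂ * p x - n₁ * q x = n₂ * p y - n₁ * q y := by linear_combination hxy
        refine hinjT x hx y hy ?_ ?_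
        · rw [h1.1, h2.1, h3]
        · rw [h1.2, h2.2, h3]
      · intro h0
        have h1 := hj m hmT
        have h3 : n₂ * p m - n₁ * q m = 0 := by linear_combination h0
        rw [h3, zero_mul, zero_mul] at h1
        exact hpq.elim (fun h => h h1.1) (fun h => h h1.2)
  · push Not at hex
    refine ⟨1, 0, Or.inl one_ne_zero, fun m hm hab hpq => ?_⟩
    have := hex m (Finset.mem_filter.2 ⟨hm, hab⟩)
    exact absurd hpq (by simp [this.1, this.2])

end LaurentComplete

/-! ### Rational holomorphic fields are Laurent polynomial -/

theorem isOpen_cstar (n : ℕ) : IsOpen (cstar n) := by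
  have : cstar n = ⋂ i, {z | z i ≠ 0} := by ext; simp [cstar]
  rw [this]
  exact isOpen_iInter_of_finite fun i => isOpen_ne_fun (continuous_apply i) continuous_const

/-- Functions on the torus are determined off the zeros of a nonzero polynomial. -/
theorem eq_zero_on_cstar {n : ℕ} {Q : MvPolynomial (Fin n) ℂ} (hQ : Q ≠ 0)
    {h : (Fin n → ℂ) → ℂ} (hc : ContinuousOn h (cstar n))
    (h0 : ∀ z ∈ cstar n, MvPolynomial.eval z Q ≠ 0 → h z = 0) : ∀ z ∈ cstar n, h z = 0 := by
  intro z hz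
  by_contra hne
  apply hQ
  have hnhds : {w | w ∈ cstar n ∧ h w ≠ 0} ∈ nhds z := by
    have h1 := (isOpen_cstar n).mem_nhds hz
    exact Filter.inter_mem h1 ((hc.continuousAt h1).eventually_ne hne)
  obtain ⟨ε, hε, hball⟩ := Metric.mem_nhds_iff.1 hnhds
  refine MvPolynomial.funext_set (fun i => Metric.ball (z i) ε) (fun i =>
    infinite_of_mem_nhds (z i) (Metric.ball_mem_nhds _ hε)) fun w hw => ?_
  rw [map_zero]
  by_contra hQw
  have : w ∈ Metric.ball z ε := by
    rw [ball_pi _ hε]; exact hw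
  exact (hball this).2 (h0 w (hball this).1 hQw)

open MvPolynomial in
/-- A continuous function on the torus that is a quotient of polynomials is a polynomial divided
by a monomial. -/
theorem exists_mul_prod_pow_eq_eval {n : ℕ} (Q : MvPolynomial (Fin n) ℂ) (hQ : Q ≠ 0)
    (g : (Fin n → ℂ) → ℂ) (P : MvPolynomial (Fin n) ℂ) (hg : ContinuousOn g (cstar n))
    (hgQ : ∀ z ∈ cstar n, g z * eval z Q = eval z P) :
    ∃ (N : ℕ) (P' : MvPolynomial (Fin n) ℂ), ∀ z ∈ cstar n,
      g z * (∏ i, z i) ^ N = eval z P' := by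
  induction Q using UniqueFactorizationMonoid.induction_on_prime generalizing g P with
  | h₁ => exact absurd rfl hQ
  | h₂ Q hu =>
    obtain ⟨R, hR⟩ := hu.exists_right_inv
    refine ⟨0, P * R, fun z hz => ?_⟩
    rw [map_mul, ← hgQ z hz, mul_assoc, ← map_mul, hR]; simp
  | h₃ Q π hQ0 hπ ih =>
    have hI : (Ideal.span {π}).IsPrime := (Ideal.span_singleton_prime hπ.ne_zero).2 hπ
    -- On the torus P = gQπ vanishes where π does; off it the product of the coordinates vanishes.
    -- The Nullstellensatz then makes π divide the product.
    have hmem : (∏ i, X i) * P ∈ vanishingIdeal ℂ (zeroLocus ℂ (Ideal.span {π})) := by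
      rw [mem_vanishingIdeal_iff]
      intro z hz
      have hπz : eval z π = 0 := by
        have := hz π (Ideal.mem_span_singleton_self π)
        rwa [← coe_aeval_eq_eval, RingHom.coe_coe]
      rw [← RingHom.coe_coe, coe_aeval_eq_eval, map_mul, map_prod]
      simp only [eval_X]
      by_cases hzc : z ∈ cstar n
      · rw [← hgQ z hzc, map_mul, hπz]; ring
      · simp only [cstar, Set.mem_ofPred_eq, not_forall, not_not] at hzc
        obtain ⟨i, hi⟩ := hzc
        rw [Finset.prod_eq_zero (Finset.mem_univ i) hi, zero_mul]
    rw [IsPrime.vanishingIdeal_zeroLocus, Ideal.mem_span_singleton] at hmem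
    have hprodc : Continuous fun z : Fin n → ℂ => ∏ i, z i := by fun_prop
    -- Either π divides the product of the coordinates and is absorbed into g, or it cancels against
    -- P.
    rcases hπ.dvd_or_dvd hmem with ⟨R, hR⟩ | ⟨R, hR⟩
    · obtain ⟨N, P', hN⟩ := ih hQ0 (fun z => g z * ∏ i, z i) (P * R) (hg.mul hprodc.continuousOn)
        (by
          intro z hz
          have h1 : ∏ i, z i = eval z π * eval z R := by
            rw [← map_mul, ← hR, map_prod]; simp
          rw [h1, map_mul, ← hgQ z hz, map_mul]; ring)
      refine ⟨N + 1, P', fun z hz => ?_⟩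
      rw [← hN z hz]; ring
    · refine ih hQ0 g R hg fun z hz => ?_
      refine sub_eq_zero.1 (eq_zero_on_cstar hπ.ne_zero
        (h := fun z => g z * eval z Q - eval z R) ?_ ?_ z hz)
      · exact (hg.mul (continuous_eval Q).continuousOn).sub (continuous_eval R).continuousOn
      · intro z hz hne
        have := hgQ z hz
        rw [hR, map_mul, map_mul] at this
        refine mul_left_cancel₀ hne ?_
        linear_combination this

theorem Finsupp.sum_sum_single_mul {ι κ : Type*} (s : Finset ι) (g : ι → κ) (c : ι → ℂ)
    (F : κ → ℂ) :
    (∑ i ∈ s, Finsupp.single (g i) (c i)).sum (fun k a => a * F k) = ∑ i ∈ s, c i * F (g i) := by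
  classical
  rw [← Finsupp.sum_finsetSum_index (by simp) (by intros; ring)]
  exact Finset.sum_congr rfl fun i _ => by rw [Finsupp.sum_single_index (zero_mul _)]

/-- The components of a rational holomorphic field on `(ℂ*)²` are Laurent polynomials. -/
theorem exists_laurent_component {X : (Fin 2 → ℂ) → (Fin 2 → ℂ)} (hX : IsRationalField X)
    (hX' : IsHolomorphicField X) (i : Fin 2) : ∃ v : ℤ × ℤ →₀ ℂ, ∀ z ∈ cstar 2,
      X z i = z i * v.sum fun m c => c * (z 0 ^ m.1 * z 1 ^ m.2) := by
  obtain ⟨P, Q, hQ, hPQ⟩ := hX i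
  have hXi : ContinuousOn (fun z => X z i) (cstar 2) :=
    (continuous_apply i).comp_continuousOn hX'.continuousOn
  have hXQ : ∀ z ∈ cstar 2, X z i * MvPolynomial.eval z Q = MvPolynomial.eval z P := by
    intro z hz
    refine sub_eq_zero.1 (eq_zero_on_cstar hQ (h := fun z => X z i * MvPolynomial.eval z Q -
      MvPolynomial.eval z P) ?_ ?_ z hz)
    · exact (hXi.mul (MvPolynomial.continuous_eval Q).continuousOn).sub
        (MvPolynomial.continuous_eval P).continuousOn
    · intro z hz hne
      rw [hPQ z hz hne, div_mul_cancel₀ _ hne, sub_self]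
  obtain ⟨N, P', hN⟩ := exists_mul_prod_pow_eq_eval (MvPolynomial.X i * Q)
    (mul_ne_zero (MvPolynomial.X_ne_zero i) hQ) (fun z => X z i / z i) P
    (hXi.div (continuous_apply i).continuousOn fun z hz => hz i) (by
      intro z hz
      rw [map_mul, MvPolynomial.eval_X, ← mul_assoc, div_mul_cancel₀ _ (hz i), hXQ z hz])
  refine ⟨∑ s ∈ P'.support, Finsupp.single ((s 0 : ℤ) - N, (s 1 : ℤ) - N) (P'.coeff s),
    fun z hz => ?_⟩
  have h0 : z 0 ≠ 0 := hz 0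
  have h1 : z 1 ≠ 0 := hz 1
  have h2 := hN z hz
  rw [MvPolynomial.eval_eq', Fin.prod_univ_two] at h2
  rw [Finsupp.sum_sum_single_mul _ _ _ (fun m : ℤ × ℤ => z 0 ^ m.1 * z 1 ^ m.2)]
  have h3 : X z i / z i = ∑ s ∈ P'.support, P'.coeff s *
      (z 0 ^ ((s 0 : ℤ) - N) * z 1 ^ ((s 1 : ℤ) - N)) := by
    refine mul_right_cancel₀ (pow_ne_zero N (mul_ne_zero h0 h1)) (h2.trans ?_)
    rw [Finset.sum_mul]
    refine Finset.sum_congr rfl fun s _ => ?_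
    rw [Fin.prod_univ_two, zpow_sub₀ h0, zpow_sub₀ h1, mul_pow]
    simp only [zpow_natCast]
    field_simp
  rw [← h3, mul_div_cancel₀ _ (hz i)]

/-! ### The converse -/

/-- Holomorphic functions on the torus that are quotients of polynomials with a denominator
without zeros on the torus. -/
def IsRegularOnTorus {n : ℕ} (g : (Fin n → ℂ) → ℂ) : Prop :=
  DifferentiableOn ℂ g (cstar n) ∧ ∃ P Q : MvPolynomial (Fin n) ℂ, ∀ z ∈ cstar n,
    MvPolynomial.eval z Q ≠ 0 ∧ g z = MvPolynomial.eval z P / MvPolynomial.eval z Q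

namespace IsRegularOnTorus

variable {n : ℕ} {f g : (Fin n → ℂ) → ℂ}

theorem const (c : ℂ) : IsRegularOnTorus fun _ : Fin n → ℂ => c :=
  ⟨differentiableOn_const c, MvPolynomial.C c, 1, fun z _ => by simp⟩

theorem apply (i : Fin n) : IsRegularOnTorus fun z : Fin n → ℂ => z i :=
  ⟨(differentiable_apply i).differentiableOn, MvPolynomial.X i, 1, fun z _ => by simp⟩

theorem inv (i : Fin n) : IsRegularOnTorus fun z : Fin n → ℂ => (z i)⁻¹ :=
  ⟨(differentiable_apply i).differentiableOn.inv fun _ hz => hz i, 1, MvPolynomial.X i,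
    fun z hz => by simpa using hz i⟩

theorem mul (hf : IsRegularOnTorus f) (hg : IsRegularOnTorus g) :
    IsRegularOnTorus fun z => f z * g z := by
  obtain ⟨hf, P, Q, hPQ⟩ := hf
  obtain ⟨hg, P', Q', hPQ'⟩ := hg
  refine ⟨hf.mul hg, P * P', Q * Q', fun z hz => ?_⟩
  simp only [map_mul, (hPQ z hz).2, (hPQ' z hz).2, div_mul_div_comm]
  exact ⟨mul_ne_zero (hPQ z hz).1 (hPQ' z hz).1, trivial⟩

theorem add (hf : IsRegularOnTorus f) (hg : IsRegularOnTorus g) :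
    IsRegularOnTorus fun z => f z + g z := by
  obtain ⟨hf, P, Q, hPQ⟩ := hf
  obtain ⟨hg, P', Q', hPQ'⟩ := hg
  refine ⟨hf.add hg, P * Q' + Q * P', Q * Q', fun z hz => ?_⟩
  simp only [map_mul, map_add, (hPQ z hz).2, (hPQ' z hz).2,
    div_add_div _ _ (hPQ z hz).1 (hPQ' z hz).1]
  exact ⟨mul_ne_zero (hPQ z hz).1 (hPQ' z hz).1, trivial⟩

theorem pow (hf : IsRegularOnTorus f) (k : ℕ) : IsRegularOnTorus fun z => f z ^ k := by
  induction k with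
  | zero => simpa using const 1
  | succ k ih => simpa only [pow_succ] using ih.mul hf

theorem zpow (i : Fin n) (k : ℤ) : IsRegularOnTorus fun z : Fin n → ℂ => z i ^ k := by
  obtain ⟨m, rfl | rfl⟩ := k.eq_nat_or_neg
  · simpa using (apply i).pow m
  · simpa using (inv i).pow m

theorem sum {ι : Type*} (s : Finset ι) {F : ι → (Fin n → ℂ) → ℂ}
    (hF : ∀ i ∈ s, IsRegularOnTorus (F i)) : IsRegularOnTorus fun z => ∑ i ∈ s, F i z := by
  classical
  induction s using Finset.induction_on with
  | empty => simpa using const 0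
  | insert i s hi ih =>
    simp only [Finset.sum_insert hi]
    exact (hF i (Finset.mem_insert_self i s)).add (ih fun j hj => hF j (Finset.mem_insert_of_mem hj))

theorem laurentValue (p : LaurentPolynomial ℂ) (k₁ k₂ : ℤ) :
    IsRegularOnTorus fun z : Fin 2 → ℂ => laurentValue p (z 0 ^ k₁ * z 1 ^ k₂) := by
  unfold _root_.laurentValue Finsupp.sum
  refine sum _ fun k _ => (const _).mul ?_
  simp only [mul_zpow, ← zpow_mul]
  exact (zpow 0 _).mul (zpow 1 _)

theorem congr (hf : IsRegularOnTorus f) (h : ∀ z ∈ cstar n, g z = f z) : IsRegularOnTorus g := by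
  obtain ⟨hf, P, Q, hPQ⟩ := hf
  exact ⟨hf.congr h, P, Q, fun z hz => by rw [h z hz]; exact hPQ z hz⟩

end IsRegularOnTorus

theorem isRationalField_and_isHolomorphicField {n : ℕ} {X : (Fin n → ℂ) → (Fin n → ℂ)}
    (hX : ∀ i, IsRegularOnTorus fun z => X z i) : IsRationalField X ∧ IsHolomorphicField X := by
  refine ⟨fun i => ?_, differentiableOn_pi.2 fun i => (hX i).1⟩
  obtain ⟨-, P, Q, hPQ⟩ := hX i
  refine ⟨P, Q, ?_, fun z hz _ => (hPQ z hz).2⟩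
  rintro rfl
  exact (hPQ (fun _ => 1) fun _ => one_ne_zero).1 (map_zero _)

/-- The primitive of `t ↦ f (w e ^ (c t))` for a Laurent polynomial `f`. -/
theorem exists_primitive_laurentValue_exp (f : LaurentPolynomial ℂ) (w c : ℂ) :
    ∃ G : ℂ → ℂ, G 0 = 0 ∧ ∀ t, HasDerivAt G (laurentValue f (w * Complex.exp (c * t))) t := by
  have hk : ∀ k : ℤ, ∃ G : ℂ → ℂ, G 0 = 0 ∧
      ∀ t, HasDerivAt G ((w * Complex.exp (c * t)) ^ k) t := by
    intro k
    have hexp : ∀ t, (w * Complex.exp (c * t)) ^ k = w ^ k * Complex.exp (k * c * t) := fun t => by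
      rw [mul_zpow, ← Complex.exp_int_mul, mul_assoc]
    simp only [hexp]
    by_cases h0 : (k : ℂ) * c = 0
    · refine ⟨fun t => w ^ k * t, by simp, fun t => ?_⟩
      simpa [h0] using (hasDerivAt_id t).const_mul (w ^ k)
    · refine ⟨fun t => w ^ k * ((Complex.exp (k * c * t) - 1) / (k * c)), by simp, fun t => ?_⟩
      have h1 := ((((hasDerivAt_id t).const_mul ((k : ℂ) * c)).cexp.sub_const 1).div_const
        ((k : ℂ) * c)).const_mul (w ^ k)
      refine h1.congr_deriv ?_
      rw [id, mul_one, mul_div_cancel_right₀ _ h0]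
  choose G hG0 hG using hk
  refine ⟨fun t => ∑ k ∈ f.coeff.support, f.coeff k * G k t, by simp [hG0], fun t => ?_⟩
  exact HasDerivAt.fun_sum fun k _ => (hG k t).const_mul _

/-- The f-terms cancel in the logarithmic derivative of w = z₁^a₁ z₂^a₂, so w = w(0) exp((a₁c₁ -
a₂c₂)t). Then each z_i has a known entire logarithmic derivative. -/
theorem isCompleteField_of_form {X : (Fin 2 → ℂ) → (Fin 2 → ℂ)} {f : LaurentPolynomial ℂ}
    {a₁ a₂ : ℤ} {c₁ c₂ : ℂ} (hX : ∀ z ∈ cstar 2,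
        X z 0 = z 0 * (a₂ * laurentValue f (z 0 ^ a₁ * z 1 ^ a₂) + c₁) ∧
        X z 1 = -(z 1 * (a₁ * laurentValue f (z 0 ^ a₁ * z 1 ^ a₂) + c₂))) :
    IsCompleteField X := by
  intro c hc
  obtain ⟨G, hG0, hG⟩ := exists_primitive_laurentValue_exp f (c 0 ^ a₁ * c 1 ^ a₂)
    (a₁ * c₁ - a₂ * c₂)
  have hlin : ∀ (u v t : ℂ), HasDerivAt (fun t => Complex.exp (u * G t + v * t))
      (Complex.exp (u * G t + v * t) * (u * laurentValue f (c 0 ^ a₁ * c 1 ^ a₂ *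
        Complex.exp ((a₁ * c₁ - a₂ * c₂) * t)) + v)) t := by
    intro u v t
    simpa using (((hG t).const_mul u).add ((hasDerivAt_id t).const_mul v)).cexp
  set γ : ℂ → (Fin 2 → ℂ) := fun t => ![c 0 * Complex.exp (a₂ * G t + c₁ * t),
    c 1 * Complex.exp (-a₁ * G t + -c₂ * t)] with hγ
  have hγmem : ∀ t, γ t ∈ cstar 2 := by
    intro t i
    fin_cases i
    · exact mul_ne_zero (hc 0) (Complex.exp_ne_zero _)
    · exact mul_ne_zero (hc 1) (Complex.exp_ne_zero _)
  refine ⟨γ, ?_, fun t => ⟨hγmem t, ?_⟩⟩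
  · ext i
    fin_cases i <;> simp [hγ, hG0]
  · have hmon : γ t 0 ^ a₁ * γ t 1 ^ a₂ =
        c 0 ^ a₁ * c 1 ^ a₂ * Complex.exp ((a₁ * c₁ - a₂ * c₂) * t) := by
      change (c 0 * Complex.exp _) ^ a₁ * (c 1 * Complex.exp _) ^ a₂ = _
      rw [mul_zpow, mul_zpow, ← Complex.exp_int_mul, ← Complex.exp_int_mul, mul_mul_mul_comm,
        ← Complex.exp_add]
      congr 2
      ring
    obtain ⟨h0, h1⟩ := hX _ (hγmem t)
    rw [hmon] at h0 h1
    rw [hasDerivAt_pi]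
    intro i
    fin_cases i
    · refine ((hlin a₂ c₁ t).const_mul (c 0)).congr_deriv ?_
      change _ = X (γ t) 0
      rw [h0, ← mul_assoc]
      rfl
    · refine ((hlin (-a₁) (-c₂) t).const_mul (c 1)).congr_deriv ?_
      change _ = X (γ t) 1
      rw [h1, ← mul_assoc]
      change _ = -(c 1 * Complex.exp (-a₁ * G t + -c₂ * t) * _)
      ring

/-! ### Assembling the normal form -/

/-- A complete field with Laurent polynomial components is of the special form. -/
theorem exists_form_of_laurentComplete {X : (Fin 2 → ℂ) → (Fin 2 → ℂ)} {S : Finset (ℤ × ℤ)}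
    {a b : ℤ × ℤ → ℂ} (hab : ∀ m ∈ S, a m ≠ 0 ∨ b m ≠ 0)
    (h₀ : ∀ z ∈ cstar 2, X z 0 = z 0 * ∑ m ∈ S, a m * (z 0 ^ m.1 * z 1 ^ m.2))
    (h₁ : ∀ z ∈ cstar 2, X z 1 = z 1 * ∑ m ∈ S, b m * (z 0 ^ m.1 * z 1 ^ m.2))
    (h : LaurentComplete S Prod.fst Prod.snd a b) :
    ∃ (f : LaurentPolynomial ℂ) (a₁ a₂ : ℤ) (c₁ c₂ : ℂ), ∀ z ∈ cstar 2,
        X z 0 = z 0 * (a₂ * laurentValue f (z 0 ^ a₁ * z 1 ^ a₂) + c₁) ∧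
        X z 1 = -(z 1 * (a₁ * laurentValue f (z 0 ^ a₁ * z 1 ^ a₂) + c₂)) := by
  classical
  obtain ⟨k₁, k₂, hk, hdir⟩ := h.exists_direction fun m _ n _ h1 h2 => Prod.ext h1 h2
  -- The relation k₁a + k₂b = 0 makes (a, b) a multiple φ of (k₂, -k₁). The exponent 0 is left out,
  -- since it supplies c₁ and c₂.
  have hex : ∀ m : ℤ × ℤ, ∃ (j : ℤ) (φ : ℂ), m ∈ S.erase 0 →
      a m = k₂ * φ ∧ b m = -(k₁ * φ) ∧ m.1 = j * k₁ ∧ m.2 = j * k₂ := by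
    intro m
    by_cases hm : m ∈ S.erase 0
    · rw [Finset.mem_erase] at hm
      have hm0 : m.1 ≠ 0 ∨ m.2 ≠ 0 := by
        by_contra! h0
        exact hm.1 (Prod.ext h0.1 h0.2)
      obtain ⟨hrel, j, hj⟩ := hdir m hm.2 (hab m hm.2) hm0
      by_cases hk₂ : k₂ = 0
      · have hk₁ : (k₁ : ℂ) ≠ 0 := Int.cast_ne_zero.2 (hk.resolve_right (not_not.2 hk₂))
        subst hk₂
        refine ⟨j, -b m / k₁, fun _ => ⟨?_, ?_, hj⟩⟩
        · simpa [hk₁] using hrel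
        · field_simp
      · have hk₂' : (k₂ : ℂ) ≠ 0 := Int.cast_ne_zero.2 hk₂
        refine ⟨j, a m / k₂, fun _ => ⟨?_, ?_, hj⟩⟩
        · field_simp
        · field_simp
          linear_combination hrel
    · exact ⟨0, 0, fun h => absurd h hm⟩
  choose j φ hφ using hex
  have hval : ∀ w, laurentValue (AddMonoidAlgebra.ofCoeff
      (∑ m ∈ S.erase 0, Finsupp.single (j m) (φ m))) w = ∑ m ∈ S.erase 0, φ m * w ^ j m :=
    fun w => Finsupp.sum_sum_single_mul _ _ _ (fun k : ℤ => w ^ k)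
  have hsum : ∀ (c : ℤ × ℤ → ℂ) (κ : ℂ), (∀ m ∈ S.erase 0, c m = κ * φ m) → ∀ z ∈ cstar 2,
      ∑ m ∈ S, c m * (z 0 ^ m.1 * z 1 ^ m.2) =
        κ * ∑ m ∈ S.erase 0, φ m * (z 0 ^ k₁ * z 1 ^ k₂) ^ j m + if 0 ∈ S then c 0 else 0 := by
    intro c κ hc z hz
    have h1 : ∑ m ∈ S.erase 0, c m * (z 0 ^ m.1 * z 1 ^ m.2) =
        κ * ∑ m ∈ S.erase 0, φ m * (z 0 ^ k₁ * z 1 ^ k₂) ^ j m := by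
      rw [Finset.mul_sum]
      refine Finset.sum_congr rfl fun m hm => ?_
      obtain ⟨-, -, e1, e2⟩ := hφ m hm
      rw [hc m hm, mul_zpow, ← zpow_mul, ← zpow_mul, mul_comm k₁, mul_comm k₂, ← e1, ← e2,
        mul_assoc]
    rw [← h1]
    split_ifs with h0
    · rw [← Finset.sum_erase_add S _ h0]; simp
    · rw [Finset.erase_eq_of_notMem h0, add_zero]
  refine ⟨AddMonoidAlgebra.ofCoeff (∑ m ∈ S.erase 0, Finsupp.single (j m) (φ m)), k₁, k₂,
    if 0 ∈ S then a 0 else 0, -if 0 ∈ S then b 0 else 0, fun z hz => ⟨?_, ?_⟩⟩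
  · rw [hval, h₀ z hz, hsum a k₂ (fun m hm => (hφ m hm).1) z hz]
  · rw [hval, h₁ z hz, hsum b (-k₁) (fun m hm => by rw [(hφ m hm).2.1]; ring) z hz]
    ring

theorem mainTheorem3 (X : (Fin 2 → ℂ) → (Fin 2 → ℂ)) :
    (IsRationalField X ∧ IsHolomorphicField X ∧ IsCompleteField X) ↔
      ∃ (f : LaurentPolynomial ℂ) (a₁ a₂ : ℤ) (c₁ c₂ : ℂ), ∀ z ∈ cstar 2,
        X z 0 = z 0 * (a₂ * laurentValue f (z 0 ^ a₁ * z 1 ^ a₂) + c₁) ∧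
        X z 1 = -(z 1 * (a₁ * laurentValue f (z 0 ^ a₁ * z 1 ^ a₂) + c₂)) := by
  classical
  constructor
  · rintro ⟨hrat, hhol, hcomp⟩
    obtain ⟨u, hu⟩ := exists_laurent_component hrat hhol 0
    obtain ⟨v, hv⟩ := exists_laurent_component hrat hhol 1
    have hu' : ∀ z ∈ cstar 2, X z 0 = z 0 * ∑ m ∈ u.support ∪ v.support,
        u m * (z 0 ^ m.1 * z 1 ^ m.2) := fun z hz => by
      rw [hu z hz, Finsupp.sum_of_support_subset _ Finset.subset_union_left _ (by simp)]
    have hv' : ∀ z ∈ cstar 2, X z 1 = z 1 * ∑ m ∈ u.support ∪ v.support,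
        v m * (z 0 ^ m.1 * z 1 ^ m.2) := fun z hz => by
      rw [hv z hz, Finsupp.sum_of_support_subset _ Finset.subset_union_right _ (by simp)]
    refine exists_form_of_laurentComplete (fun m hm => ?_) hu' hv' ?_
    · simpa using hm
    · intro c₁ c₂ hc₁ hc₂
      obtain ⟨γ, hγ0, hγ⟩ := hcomp ![c₁, c₂] (by
        intro i; fin_cases i
        · exact hc₁
        · exact hc₂)
      refine ⟨fun t => γ t 0, fun t => γ t 1, by simp [hγ0], by simp [hγ0], fun t => ?_⟩
      obtain ⟨hmem, hder⟩ := hγ t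
      rw [hasDerivAt_pi] at hder
      refine ⟨hmem 0, hmem 1, ?_, ?_⟩
      · rw [← hu' _ hmem]; exact hder 0
      · rw [← hv' _ hmem]; exact hder 1
  · rintro ⟨f, a₁, a₂, c₁, c₂, hX⟩
    have hf := IsRegularOnTorus.laurentValue f a₁ a₂
    obtain ⟨hrat, hhol⟩ := isRationalField_and_isHolomorphicField (X := X) (by
      intro i
      fin_cases i
      · exact ((IsRegularOnTorus.apply 0).mul (((IsRegularOnTorus.const a₂).mul hf).add
          (IsRegularOnTorus.const c₁))).congr fun z hz => (hX z hz).1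
      · refine ((IsRegularOnTorus.const (-1)).mul ((IsRegularOnTorus.apply 1).mul
          (((IsRegularOnTorus.const a₁).mul hf).add
          (IsRegularOnTorus.const c₂)))).congr fun z hz => ?_
        rw [neg_one_mul]; exact (hX z hz).2)
    exact ⟨hrat, hhol, isCompleteField_of_form hX⟩
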